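/- **Setting.** An instance of the informative path planning problem (IPP) consists of a finite set $X$ of locations and a root $r\notin X$; a symmetric distance $d$ on $X\cup\{r\}$ with the triangle inequality; a finite set $M$ of $m$ scenarios with prior probabilities $p_\omega>0$, $\sum_{\omega\in M}p_\omega=1$; a set $O$ of observations, where location $v$ shows $\omega(v)\in O$ under scenario $\omega$; and a monotone submodular function $f$ from sets of pairs in $X\times O$ to $\mathbb{Z}_{\ge 0}$ with maximal value $Q$. For $S\subseteq X$ put $\psi_\omega(S)=\{(v,\omega(v)):v\in S\}$; it is assumed that $f(\psi_\omega(X))=Q$ for all $\omega\in M$. The true scenario $\omega^*$ is drawn from $p$; visiting $v$ reveals $\omega^*(v)$. A solution is a tour from $r$ back to $r$, possibly chosen adaptively, which for every $\omega\in M$ visits, when $\omega^*=\omega$, a set $R$ of locations with $f(\psi_\omega(R))=Q$; its cost is its expected length. A fully adaptive solution may choose each next location depending on all observations so far. A $k$-round solution proceeds in at most $k$ rounds: in each round it fixes a tour depending only on the observations of earlier rounds, and follows it until a stopping rule (depending on the observations) applies, when the next round starts. **Orienteering.** In ratio submodular orienteering one is given $X,r,d$ and a monotone submodular $g:2^X\to\mathbb{R}_{\ge0}$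 with $g(\emptyset)=0$, and seeks an $r$-tour $T$ maximizing $g(T)/d(T)$. Let $\mathcal A$ be a (deterministic or nondeterministic) $\rho$-approximation procedure for it, $\rho\ge1$: it always returns a tour whose ratio is at least $1/\rho$ times the maximum. (Here $a/0=\infty$ for $a>0$, and $0/0=0$.) **Partial covering algorithm $\mathrm{PCA}(\mathcal I,\delta)$.** *Planning.* Start with $S=\emptyset$ and the empty list $\Pi$. Let $\mathcal Z$ be the set of those classes $Z$ of the partition of $M$ by $\omega\mapsto\psi_\omega(S)$ with $|Z|\ge\delta m$ and $f(\psi_Z(S))<Q$, where $\psi_Z(S)$ is the common realization. For $v\in X$ let $L_v(Z)$ be $Z$ minus a largest class of the partition of $Z$ by $\omega\mapsto\omega(v)$ (ties broken arbitrarily), and $L_T(Z)=\bigcup_{v\in T}L_v(Z)$. While $S\ne X$ and $\mathcal Z\neq\emptyset$, use $\mathcal A$ to select a tour $T$ that $\rho$-approximately maximizes $$\frac1{d(T)}\sum_{Z\in\mathcal Z}\Big(\sum_{\omega\in L_T(Z)}p_\omega+\sum_{\omega\in Z}p_\omega\frac{f(\psi_Z(S)\cup\psi_\omega(T))-f(\psi_Z(S))}{Q-f(\psi_Z(S))}\Big),$$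 append $T$ to $\Pi$ and replace $S$ by $S\cup T$. *Execution.* Traverse the tours of $\Pi$ in order; before each one, stop if the observed partial realization $\psi$ satisfies $f(\psi)=Q$ or fewer than $\delta m$ scenarios are compatible with $\psi$. **Algorithm $k\text{-ADAP}(\mathcal I,k)$.** If $k=0$, do nothing. Otherwise run $\mathrm{PCA}(\mathcal I,m^{-1/k})$ as one round; let $R,\psi,H$ be the visited locations, the observed partial realization and the compatible scenarios; then run $k\text{-ADAP}(\widehat{\mathcal I},k-1)$ on the residual instance $\widehat{\mathcal I}$ with locations $X\setminus R$, scenarios $H$, the prior conditioned on $H$, the function $f_\psi(\phi)=f(\psi\cup\phi)-f(\psi)$ and target $Q-f(\psi)$. **Theorem.** There is an absolute constant $C>0$ such that for every instance, every $k\ge1$, every $\rho\ge 1$ and every $\rho$-approximation procedure $\mathcal A$, the algorithm $k\text{-ADAP}$ can be carried out, and however the choices in it are made, it yields a $k$-round solution (it covers every scenario within $k$ rounds) whose expected cost is at most $$C\cdot\rho\cdot m^{1/k}\cdot\big(\log m+k\log(Q+1)\big)$$ times the expected cost of an optimal fully adaptive solution (and hence, if $Q\ge2$, is $O(\rho\,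 m^{1/k}(\log m+k\log Q))$ times that cost). -/

import Mathlib

open scoped Classical

noncomputable section

/-! Informative path planning. The sensing locations live in a type `V`; a position of the robot is an
element of `Option V`, where `none` is the root `r` and `some v` is the location `v`. The metric on
locations and root is a `PseudoMetricSpace` structure on `Option V` (distinct points at distance zero
are allowed). -/

/-- Length of the walk that starts at `x`, goes through the listed positions and ends at the root. -/
def returnLength {V : Type*} [PseudoMetricSpace (Option V)] :
    Option V → List (Option V) → ℝ
  | x, [] => dist x none
  | x, y :: w => dist x y + returnLength y w

/-- Length of the closed walk root, listed positions, root. -/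
def tourLength {V : Type*} [PseudoMetricSpace (Option V)] (w : List (Option V)) : ℝ :=
  returnLength none w

/-- The partial realization on the set `S` of locations when location `v` shows `o v`. -/
def realization {V O : Type*} (o : V → O) (S : Finset V) : Finset (V × O) :=
  S.image fun v => (v, o v)

/-- The partial realization observed along a walk (nothing is observed at the root). -/
def sensed {V O : Type*} (o : V → O) (w : List (Option V)) : Finset (V × O) :=
  realization o w.reduceOption.toFinset

/-! ### Ratio submodular orienteering -/

/-- `g`, on subsets of `X`, is a monotone submodular function with `g ∅ = 0`. -/
structure IsMonoSubmodular {V : Type*} (X : Finset V) (g : Finset V → ℝ) : Prop where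
  empty : g ∅ = 0
  mono : ∀ A B : Finset V, A ⊆ B → B ⊆ X → g A ≤ g B
  submod : ∀ A B : Finset V, ∀ v ∈ X, A ⊆ B → B ⊆ X → v ∉ B →
    g (insert v B) - g B ≤ g (insert v A) - g A

/-- The ratio `g(T) / d(T)` of a root tour `T`; in `ℝ≥0∞`, `a / 0 = ∞` for `a > 0` and `0 / 0 = 0`. -/
def tourRatio {V : Type*} [PseudoMetricSpace (Option V)] (g : Finset V → ℝ) (T : List V) :
    ENNReal :=
  ENNReal.ofReal (g T.toFinset) / ENNReal.ofReal (tourLength (T.map some))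

/-- `A X g T` says that `T` is a possible output of the (deterministic or not) procedure `A` on the
ratio submodular orienteering instance with locations `X` and function `g`. The procedure is a
`ρ`-approximation: it always has an output, and all its outputs are tours in `X` whose
ratio is at least `1 / ρ` times the ratio of every tour in `X`. -/
def IsRSOApprox {V : Type*} [PseudoMetricSpace (Option V)] (ρ : ℝ)
    (A : Finset V → (Finset V → ℝ) → List V → Prop) : Prop :=
  ∀ (X : Finset V) (g : Finset V → ℝ), IsMonoSubmodular X g →
    (∃ T, A X g T) ∧
    ∀ T, A X g T → (∀ v ∈ T, v ∈ X) ∧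
      ∀ T' : List V, (∀ v ∈ T', v ∈ X) → tourRatio g T' ≤ ENNReal.ofReal ρ * tourRatio g T

/-! ### Instances -/

/-- The data of an instance: locations `X`, scenarios `M`, prior `p`, observation `obs ω v` at
`v` under scenario `ω`, utility `f` on sets of location-observation pairs, target `Q`. -/
structure IPP (V Ω O : Type*) where
  X : Finset V
  M : Finset Ω
  p : Ω → ℝ
  obs : Ω → V → O
  f : Finset (V × O) → ℕ
  Q : ℕ

namespace IPP

variable {V Ω O : Type*}

/-- The standing assumptions on an instance. -/
structure IsValid (I : IPP V Ω O) : Prop where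
  p_pos : ∀ ω ∈ I.M, 0 < I.p ω
  p_sum : ∑ ω ∈ I.M, I.p ω = 1
  mono : ∀ A B : Finset (V × O), A ⊆ B → (∀ e ∈ B, e.1 ∈ I.X) → I.f A ≤ I.f B
  submod : ∀ (A B : Finset (V × O)) (e : V × O), A ⊆ B → (∀ e' ∈ B, e'.1 ∈ I.X) →
    e.1 ∈ I.X → e ∉ B → I.f (insert e B) + I.f A ≤ I.f (insert e A) + I.f B
  le_Q : ∀ A : Finset (V × O), (∀ e ∈ A, e.1 ∈ I.X) → I.f A ≤ I.Q
  cover : ∀ ω ∈ I.M, I.f (realization (I.obs ω) I.X) = I.Q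

/-- The scenarios compatible with a partial realization. -/
def compatible (I : IPP V Ω O) (ψ : Finset (V × O)) : Finset Ω :=
  I.M.filter fun ω => ∀ e ∈ ψ, I.obs ω e.1 = e.2

/-- The residual instance after observing `ψ`: visited locations are removed, the prior is conditioned
on the compatible scenarios, and `f` is replaced by `φ ↦ f (ψ ∪ φ) - f ψ`. -/
def residual (I : IPP V Ω O) (ψ : Finset (V × O)) : IPP V Ω O where
  X := I.X \ ψ.image Prod.fst
  M := I.compatible ψ
  p := fun ω => I.p ω / ∑ ω' ∈ I.compatible ψ, I.p ω'
  obs := I.obs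
  f := fun φ => I.f (ψ ∪ φ) - I.f ψ
  Q := I.Q - I.f ψ

/-- Given the walk made under each scenario: only locations of the instance are visited,
and the observed partial realization covers `f`, whatever the true scenario. -/
def Covers (I : IPP V Ω O) (w : Ω → List (Option V)) : Prop :=
  ∀ ω ∈ I.M, (∀ v, some v ∈ w ω → v ∈ I.X) ∧ I.f (sensed (I.obs ω) (w ω)) = I.Q

/-- Expected length of the tour, given the walk made under each scenario. -/
def expectedCost [PseudoMetricSpace (Option V)] (I : IPP V Ω O) (w : Ω → List (Option V)) : ℝ :=
  ∑ ω ∈ I.M, I.p ω * tourLength (w ω)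

end IPP

/-! ### Solutions -/

/-- A fully adaptive policy is a decision tree: after each observation it decides which location to
visit next, or to end (and return to the root). -/
inductive AdaptivePolicy (V O : Type*) where
  | halt : AdaptivePolicy V O
  | visit (v : V) (next : O → AdaptivePolicy V O) : AdaptivePolicy V O

/-- The walk made by an adaptive policy when location `v` shows `o v`. -/
def AdaptivePolicy.walk {V O : Type*} (o : V → O) : AdaptivePolicy V O → List (Option V)
  | .halt => []
  | .visit v next => some v :: (next (o v)).walk o

/-- A `k`-round policy. A round consists of a walk, fixed before the round starts, and a stopping rule,
after which the next round, which may depend on the observations made so far, starts. The walk is given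
as the concatenation of `legs`, and the stopping rule is consulted before each leg, on the partial
realization observed in this round (legs of length one let the rule act after every location). -/
inductive KRoundPolicy (V O : Type*) : ℕ → Type _ where
  | done : KRoundPolicy V O 0
  | round {k : ℕ} (legs : List (List (Option V))) (rule : Finset (V × O) → Prop)
      (next : Finset (V × O) → KRoundPolicy V O k) : KRoundPolicy V O (k + 1)

/-- The walk made in one round: `w` is the part already made, the list holds the remaining legs. -/
def roundWalk {V O : Type*} (o : V → O) (rule : Finset (V × O) → Prop) :
    List (Option V) → List (List (Option V)) → List (Option V)
  | w, [] => w
  | w, leg :: legs => if rule (sensed o w) then w else roundWalk o rule (w ++ leg) legs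

/-- The walk made by a `k`-round policy when location `v` shows `o v`. -/
def KRoundPolicy.walk {V O : Type*} (o : V → O) :
    {k : ℕ} → KRoundPolicy V O k → List (Option V)
  | _, .done => []
  | _, .round legs rule next =>
    roundWalk o rule [] legs ++ (next (sensed o (roundWalk o rule [] legs))).walk o

/-! ### The partial covering algorithm -/

namespace IPP

variable {V Ω O : Type*}

/-- The part of `Z` of the scenarios with the same observation at `v` as `ω`. -/
def partAt (I : IPP V Ω O) (v : V) (Z : Finset Ω) (ω : Ω) : Finset Ω :=
  Z.filter fun ω' => I.obs ω' v = I.obs ω v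

/-- `B v Z` is, for each `v` and `Z`, a part of largest cardinality of the partition of `Z` according
to the observation at `v` (ties are broken arbitrarily). -/
def IsLargestPart (I : IPP V Ω O) (B : V → Finset Ω → Finset Ω) : Prop :=
  ∀ v ∈ I.X, ∀ Z : Finset Ω, Z ⊆ I.M → Z.Nonempty →
    (∃ ω ∈ Z, B v Z = I.partAt v Z ω) ∧ ∀ ω ∈ Z, (I.partAt v Z ω).card ≤ (B v Z).card

/-- The partition of the scenarios according to their realization on `S`. -/
def parts (I : IPP V Ω O) (S : Finset V) : Finset (Finset Ω) :=
  I.M.image fun ω => I.M.filter fun ω' => ∀ v ∈ S, I.obs ω' v = I.obs ω v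

/-- The parts of `parts S` to which the stopping rule does not apply: those with at least `δ |M|` scenarios under
which `f` is not yet covered. -/
def activeParts (I : IPP V Ω O) (δ : ℝ) (S : Finset V) : Finset (Finset Ω) :=
  (I.parts S).filter fun Z =>
    δ * (I.M.card : ℝ) ≤ (Z.card : ℝ) ∧ ∀ ω ∈ Z, I.f (realization (I.obs ω) S) < I.Q

/-- The numerator of the score of a new tour with set of locations `T`, after `S`: the information gain
plus the relative function gain, summed over the active parts. -/
def gain (I : IPP V Ω O) (B : V → Finset Ω → Finset Ω) (δ : ℝ) (S T : Finset V) : ℝ :=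
  ∑ Z ∈ I.activeParts δ S,
    ((∑ ω ∈ T.biUnion fun v => Z \ B v Z, I.p ω) +
      ∑ ω ∈ Z, I.p ω *
        (((I.f (realization (I.obs ω) S ∪ realization (I.obs ω) T) : ℝ)
            - (I.f (realization (I.obs ω) S) : ℝ)) /
          ((I.Q : ℝ) - (I.f (realization (I.obs ω) S) : ℝ))))

/-- `I.Plan A δ S Ts`: with `S` the locations selected so far, the planning loop can
select the tours `Ts` and end; each tour is an output of the procedure `A`. -/
inductive Plan (I : IPP V Ω O) (A : Finset V → (Finset V → ℝ) → List V → Prop) (δ : ℝ) :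
    Finset V → List (List V) → Prop
  | finish (S : Finset V) (h : S = I.X ∨ I.activeParts δ S = ∅) : Plan I A δ S []
  | select (S : Finset V) (B : V → Finset Ω → Finset Ω) (T : List V) (Ts : List (List V))
      (hS : S ≠ I.X) (hZ : I.activeParts δ S ≠ ∅) (hB : I.IsLargestPart B)
      (hT : A I.X (I.gain B δ S) T) (hTs : Plan I A δ (S ∪ T.toFinset) Ts) :
      Plan I A δ S (T :: Ts)

/-- The planned tours as the legs of one round: each tour is followed by a return to the root. -/
def legsOf (Ts : List (List V)) : List (List (Option V)) :=
  Ts.map fun T => T.map some ++ [none]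

/-- The stopping rule of the partial covering algorithm: fewer than `δ |M|` scenarios are compatible,
or `f` is covered. -/
def stopRule (I : IPP V Ω O) (δ : ℝ) (ψ : Finset (V × O)) : Prop :=
  ¬ (δ * (I.M.card : ℝ) ≤ ((I.compatible ψ).card : ℝ) ∧ I.f ψ < I.Q)

/-- The parameter `δ = m ^ (-1 / k)`. -/
def delta (I : IPP V Ω O) (k : ℕ) : ℝ :=
  (I.M.card : ℝ) ^ (-(1 / (k : ℝ)))

/-- `KAdap A k I P`: the `k`-round algorithm with orienteering procedure `A` can behave on `I` as the
policy `P`. It runs the partial covering algorithm with `δ = m ^ (-1 / k)` as its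
first round and then, for each outcome `ψ` of that round, itself with `k - 1` rounds on
the residual instance. -/
inductive KAdap (A : Finset V → (Finset V → ℝ) → List V → Prop) :
    (k : ℕ) → IPP V Ω O → KRoundPolicy V O k → Prop
  | zero (I : IPP V Ω O) : KAdap A 0 I .done
  | succ (k : ℕ) (I : IPP V Ω O) (Ts : List (List V))
      (next : Finset (V × O) → KRoundPolicy V O k)
      (hTs : I.Plan A (I.delta (k + 1)) ∅ Ts)
      (hnext : ∀ ω ∈ I.M, ∀ ψ : Finset (V × O),
        ψ = sensed (I.obs ω)
          (roundWalk (I.obs ω) (I.stopRule (I.delta (k + 1))) [] (legsOf Ts)) →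
        KAdap A k (I.residual ψ) (next ψ)) :
      KAdap A (k + 1) I (.round (legsOf Ts) (I.stopRule (I.delta (k + 1))) next)

end IPP

end

/-! One round run with parameter `δ` costs at most `16 ρ (1/δ) (log (1/δ) + log (Q+1))` times any
adaptive solution (`expectedCost_round_le`). Each active part holds at least `δ m` scenarios, so
there are at most `1/δ` of them. Fix a budget `t`. In each active part, follow the adaptive tree
along the majority observations, among scenarios of cost at most `t`. Joining these walks gives a
tour of length at most `t/δ` on which every active scenario of cost at most `t` gains at least `1`:
it leaves the majority somewhere, or its whole covering walk is made (`exists_tour_gain_ge`). Hence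
the greedy tour has a good ratio.

A single scenario gains only `O(log (1/δ) + log (Q+1))` in total, because its part halves and its
residual target shrinks (`sum_scenarioGain_le`). The lemma `sum_cost_le_of_greedy` combines the two
bounds. It takes `t` at the median level of the active mass, charges each tour to the gains it
yields, and compares the charges with the adaptive cost through their tails.

For several rounds, `δ = m ^ (-1/(k+1))` leaves either a reached target or fewer than `m ^
(k/(k+1))` scenarios. The remaining `k` rounds then again have the factor `m ^ (1/(k+1))`, since `(m
^ (k/(k+1))) ^ (1/k) = m ^ (1/(k+1))`. Pruning the adaptive policy solves the residual instances at
no larger cost, so the bounds of the rounds add up (`KAdap.expectedCost_le`). -/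

section Walks

/-! ### Lengths of walks and the observations made on them. -/

variable {V O : Type*}

lemma returnLength_nonneg [PseudoMetricSpace (Option V)] (x : Option V) (w : List (Option V)) :
    0 ≤ returnLength x w := by
  induction w generalizing x with
  | nil => exact dist_nonneg
  | cons y w ih => exact add_nonneg dist_nonneg (ih y)

lemma tourLength_nonneg [PseudoMetricSpace (Option V)] (w : List (Option V)) :
    0 ≤ tourLength w :=
  returnLength_nonneg none w

lemma tourLength_nil [PseudoMetricSpace (Option V)] :
    tourLength ([] : List (Option V)) = 0 :=
  dist_self _

lemma returnLength_le_dist_add [PseudoMetricSpace (Option V)] (x y : Option V)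
    (w : List (Option V)) : returnLength x w ≤ dist x y + returnLength y w := by
  cases w with
  | nil => exact dist_triangle _ _ _
  | cons z w =>
    have := dist_triangle x y z
    simp only [returnLength]
    linarith

lemma returnLength_append_le [PseudoMetricSpace (Option V)] (x : Option V)
    (w w' : List (Option V)) :
    returnLength x (w ++ w') ≤ returnLength x w + tourLength w' := by
  induction w generalizing x with
  | nil => exact returnLength_le_dist_add x none w'
  | cons y w ih =>
    have := ih y
    simp only [returnLength, List.cons_append]
    linarith

/-- The joined walk shortcuts the intermediate return to the root. -/
lemma tourLength_append_le [PseudoMetricSpace (Option V)] (w w' : List (Option V)) :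
    tourLength (w ++ w') ≤ tourLength w + tourLength w' :=
  returnLength_append_le none w w'

lemma tourLength_append_root_le [PseudoMetricSpace (Option V)] (w : List (Option V)) :
    tourLength (w ++ [none]) ≤ tourLength w := by
  have h := tourLength_append_le w [none]
  have : tourLength ([none] : List (Option V)) = 0 := by simp [tourLength, returnLength]
  linarith

lemma tourLength_flatMap_le [PseudoMetricSpace (Option V)] {ι : Type*} (l : List ι)
    (w : ι → List (Option V)) :
    tourLength (l.flatMap w) ≤ (l.map fun i => tourLength (w i)).sum := by
  induction l with
  | nil => simp [tourLength_nil]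
  | cons i l ih =>
    have := tourLength_append_le (w i) (l.flatMap w)
    simp only [List.flatMap_cons, List.map_cons, List.sum_cons]
    linarith

/-- Triangle inequality at each skipped stop. It makes pruned policies no more expensive than the
original ones. -/
lemma returnLength_le_of_sublist [PseudoMetricSpace (Option V)] {w w' : List (Option V)}
    (h : w.Sublist w') (x : Option V) : returnLength x w ≤ returnLength x w' := by
  induction h generalizing x with
  | slnil => exact le_rfl
  | cons y _ ih =>
    exact (returnLength_le_dist_add x y _).trans (add_le_add_right (ih y) _)
  | cons_cons y _ ih => exact add_le_add_right (ih y) _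

lemma mem_sensed {o : V → O} {w : List (Option V)} {e : V × O} :
    e ∈ sensed o w ↔ some e.1 ∈ w ∧ o e.1 = e.2 := by
  rcases e with ⟨v, x⟩
  simp only [sensed, realization, Finset.mem_image, List.mem_toFinset,
    List.reduceOption_mem_iff, Prod.mk.injEq]
  constructor
  · rintro ⟨a, ha, rfl, rfl⟩
    exact ⟨ha, rfl⟩
  · rintro ⟨hv, rfl⟩
    exact ⟨v, hv, rfl, rfl⟩

lemma mem_realization {o : V → O} {S : Finset V} {e : V × O} :
    e ∈ realization o S ↔ e.1 ∈ S ∧ o e.1 = e.2 := by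
  rcases e with ⟨v, x⟩
  simp only [realization, Finset.mem_image, Prod.mk.injEq]
  constructor
  · rintro ⟨a, ha, rfl, rfl⟩
    exact ⟨ha, rfl⟩
  · rintro ⟨hv, rfl⟩
    exact ⟨v, hv, rfl, rfl⟩

lemma sensed_append (o : V → O) (w w' : List (Option V)) :
    sensed o (w ++ w') = sensed o w ∪ sensed o w' := by
  ext e
  simp only [mem_sensed, List.mem_append, Finset.mem_union]
  tauto

lemma sensed_nil (o : V → O) : sensed o ([] : List (Option V)) = ∅ := by
  ext e; simp [mem_sensed]

lemma realization_union (o : V → O) (S T : Finset V) :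
    realization o (S ∪ T) = realization o S ∪ realization o T :=
  Finset.image_union _ _

lemma realization_mono (o : V → O) {S T : Finset V} (h : S ⊆ T) :
    realization o S ⊆ realization o T :=
  Finset.image_subset_image h

lemma realization_empty (o : V → O) : realization o (∅ : Finset V) = ∅ := rfl

lemma realization_congr {o o' : V → O} {S : Finset V} (h : ∀ v ∈ S, o v = o' v) :
    realization o S = realization o' S :=
  Finset.image_congr fun v hv => by simp [h v hv]

end Walks

/-! ### Comparison of a greedy list with a reference cost -/

section Accounting

/-- If the tail probabilities of `τ` are at most `K` times those of `c`, so are the expectations. -/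
lemma sum_mul_le_of_tail_le {Ω : Type*} (M : Finset Ω) (p τ c : Ω → ℝ) (K : ℝ) (hK : 0 ≤ K)
    (hp : ∀ ω ∈ M, 0 ≤ p ω) (hτ : ∀ ω ∈ M, 0 ≤ τ ω) (hc : ∀ ω ∈ M, 0 ≤ c ω)
    (h : ∀ s : ℝ, 0 ≤ s →
      ∑ ω ∈ M with s < τ ω, p ω ≤ K * ∑ ω ∈ M with s < c ω, p ω) :
    ∑ ω ∈ M, p ω * τ ω ≤ K * ∑ ω ∈ M, p ω * c ω := by
  -- Layer-cake formula: `q ω` is the length of the set of `s ≥ 0` with `s < q ω`.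
  have key : ∀ q : Ω → ℝ, (∀ ω ∈ M, 0 ≤ q ω) → ENNReal.ofReal (∑ ω ∈ M, p ω * q ω) =
      ∫⁻ s in Set.Ici (0 : ℝ), ENNReal.ofReal (∑ ω ∈ M with s < q ω, p ω) := by
    intro q hq
    have h1 : ∀ s : ℝ, ENNReal.ofReal (∑ ω ∈ M with s < q ω, p ω) =
        ∑ ω ∈ M, (Set.Iio (q ω)).indicator (fun _ => ENNReal.ofReal (p ω)) s := by
      intro s
      rw [ENNReal.ofReal_sum_of_nonneg fun ω hω => hp ω (Finset.mem_filter.1 hω).1,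
        Finset.sum_filter]
      exact Finset.sum_congr rfl fun ω _ => by simp [Set.indicator_apply]
    simp_rw [h1]
    rw [MeasureTheory.lintegral_finsetSum _
      fun ω _ => measurable_const.indicator measurableSet_Iio,
      ENNReal.ofReal_sum_of_nonneg fun ω hω => mul_nonneg (hp ω hω) (hq ω hω)]
    refine Finset.sum_congr rfl fun ω hω => ?_
    rw [MeasureTheory.lintegral_indicator measurableSet_Iio, MeasureTheory.lintegral_const,
      MeasureTheory.Measure.restrict_restrict measurableSet_Iio,
      MeasureTheory.Measure.restrict_apply_univ, Set.Iio_inter_Ici, Real.volume_Ico, sub_zero,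
      ENNReal.ofReal_mul (hp ω hω)]
  have h0 : 0 ≤ ∑ ω ∈ M, p ω * c ω :=
    Finset.sum_nonneg fun ω hω => mul_nonneg (hp ω hω) (hc ω hω)
  rw [← ENNReal.ofReal_le_ofReal_iff (mul_nonneg hK h0), ENNReal.ofReal_mul hK, key τ hτ,
    key c hc, ← MeasureTheory.lintegral_const_mul' _ _ ENNReal.ofReal_ne_top]
  refine MeasureTheory.setLIntegral_mono' measurableSet_Ici fun s hs => ?_
  rw [← ENNReal.ofReal_mul hK]
  exact ENNReal.ofReal_le_ofReal (h s hs)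

/-- Existence of upper quantiles for a finitely supported law. -/
lemma exists_upper_quantile {Ω : Type*} (M : Finset Ω) (p c : Ω → ℝ)
    (hc : ∀ ω ∈ M, 0 ≤ c ω) (b : ℝ) (hb : 0 ≤ b) :
    ∃ t : ℝ, 0 ≤ t ∧ ∑ ω ∈ M with t < c ω, p ω ≤ b ∧
      ∀ s, 0 ≤ s → s < t → b < ∑ ω ∈ M with s < c ω, p ω := by
  -- The tail of `c` changes only at its values, so the quantile is the least good point of this
  -- grid. The point `0` guarantees a grid point below every `s ≥ 0`.
  set G : Finset ℝ := insert 0 (M.image c) with hG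
  have hGne : G.Nonempty := ⟨0, Finset.mem_insert_self _ _⟩
  have hne : (G.filter fun t => ∑ ω ∈ M with t < c ω, p ω ≤ b).Nonempty := by
    refine ⟨G.max' hGne, Finset.mem_filter.2 ⟨Finset.max'_mem _ _, ?_⟩⟩
    rw [Finset.filter_false_of_mem]
    · simpa using hb
    · intro ω hω
      exact not_lt.2 (Finset.le_max' _ _
        (Finset.mem_insert_of_mem (Finset.mem_image_of_mem c hω)))
  obtain ⟨t, ht, hmin⟩ := Finset.exists_min_image _ id hne
  rw [Finset.mem_filter] at ht
  refine ⟨t, ?_, ht.2, ?_⟩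
  · rcases Finset.mem_insert.1 ht.1 with h | h
    · exact h.ge
    · obtain ⟨ω, hω, rfl⟩ := Finset.mem_image.1 h
      exact hc ω hω
  · intro s hs hst
    by_contra! hcon
    have hne' : (G.filter fun r => r ≤ s).Nonempty :=
      ⟨0, Finset.mem_filter.2 ⟨Finset.mem_insert_self _ _, hs⟩⟩
    set r := (G.filter fun r => r ≤ s).max' hne' with hr
    have hrmem := Finset.mem_filter.1 (Finset.max'_mem _ hne')
    have heq : (M.filter fun ω => r < c ω) = M.filter fun ω => s < c ω := by
      refine Finset.filter_congr fun ω hω => ⟨fun h => ?_, fun h => lt_of_le_of_lt hrmem.2 h⟩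
      by_contra! hle
      exact absurd (Finset.le_max' (G.filter fun r => r ≤ s) (c ω) (Finset.mem_filter.2
        ⟨Finset.mem_insert_of_mem (Finset.mem_image_of_mem c hω), hle⟩)) (not_le.2 h)
    have := hmin r (Finset.mem_filter.2 ⟨hrmem.1, by rw [heq]; exact hcon⟩)
    exact absurd (this.trans hrmem.2) (not_le.2 hst)

/-- A greedy list whose `j`-th entry costs `d j`, is paid by the scenarios in the decreasing sets
`act j`, and yields gains `g j`, against a reference solution with cost `c`. -/
lemma sum_cost_le_of_greedy {Ω : Type*} (M : Finset Ω) (p c : Ω → ℝ)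
    (hp : ∀ ω ∈ M, 0 ≤ p ω) (hc : ∀ ω ∈ M, 0 ≤ c ω)
    (n : ℕ) (d : ℕ → ℝ) (act : ℕ → Finset Ω) (g : ℕ → Ω → ℝ) (K L : ℝ)
    (hK : 0 ≤ K) (hL : 0 ≤ L) (hact : ∀ j, act j ⊆ M)
    (hanti : ∀ i j, i ≤ j → act j ⊆ act i)
    (hg : ∀ j < n, ∀ ω ∈ act j, 0 ≤ g j ω)
    (hsum : ∀ ω ∈ M, ∑ j ∈ Finset.range n, (if ω ∈ act j then g j ω else 0) ≤ L)
    (hgreedy : ∀ j < n, ∀ t, 0 ≤ t →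
      d j * (∑ ω ∈ act j, p ω - ∑ ω ∈ M with t < c ω, p ω) ≤
        K * t * ∑ ω ∈ act j, p ω * g j ω)
    (hd : ∀ j < n, 0 ≤ d j) :
    ∑ j ∈ Finset.range n, d j * ∑ ω ∈ act j, p ω ≤ 4 * K * L * ∑ ω ∈ M, p ω * c ω := by
  -- The threshold `t j` is the least one for which the scenarios of cost above it weigh at most
  -- half of the active mass.
  have hquant : ∀ j, ∃ t : ℝ, 0 ≤ t ∧ ∑ ω ∈ M with t < c ω, p ω ≤ (∑ ω ∈ act j, p ω) / 2 ∧
      ∀ s, 0 ≤ s → s < t → (∑ ω ∈ act j, p ω) / 2 < ∑ ω ∈ M with s < c ω, p ω := fun j =>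
    exists_upper_quantile M p c hc _
      (div_nonneg (Finset.sum_nonneg fun ω hω => hp ω (hact j hω)) zero_le_two)
  choose t ht0 htle htlt using hquant
  -- The price `τ ω` is the largest threshold met while `ω` is active, and `0` if it never is.
  have hτ : ∀ ω, ∃ τ : ℝ, 0 ≤ τ ∧ (∀ j < n, ω ∈ act j → t j ≤ τ) ∧
      ∀ s, 0 ≤ s → s < τ → ∃ j < n, ω ∈ act j ∧ s < t j := by
    intro ω
    have hne : (insert 0 (((Finset.range n).filter fun j => ω ∈ act j).image t)).Nonempty :=
      ⟨0, Finset.mem_insert_self _ _⟩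
    refine ⟨Finset.max' _ hne, Finset.le_max' _ _ (Finset.mem_insert_self _ _), ?_, ?_⟩
    · intro j hj hω
      exact Finset.le_max' _ _ (Finset.mem_insert_of_mem (Finset.mem_image_of_mem t
        (Finset.mem_filter.2 ⟨Finset.mem_range.2 hj, hω⟩)))
    · intro s hs hlt
      rcases Finset.mem_insert.1 (Finset.max'_mem _ hne) with h | h
      · rw [h] at hlt
        exact absurd hlt (not_lt.2 hs)
      · obtain ⟨j, hj, hjt⟩ := Finset.mem_image.1 h
        rw [Finset.mem_filter, Finset.mem_range] at hj
        exact ⟨j, hj.1, hj.2, by rw [hjt]; exact hlt⟩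
  choose τ hτ0 hτle hτlt using hτ
  have htail : ∑ ω ∈ M, p ω * τ ω ≤ 2 * ∑ ω ∈ M, p ω * c ω := by
    refine sum_mul_le_of_tail_le M p τ c 2 zero_le_two hp (fun ω _ => hτ0 ω) hc fun s hs => ?_
    have hnn : 0 ≤ ∑ ω ∈ M with s < c ω, p ω :=
      Finset.sum_nonneg fun ω hω => hp ω (Finset.mem_filter.1 hω).1
    by_cases hex : ∃ j, j < n ∧ s < t j
    -- At the first `j` with `s < t j`, every scenario with `τ ω > s` is active, since the active
    -- sets decrease. By minimality of `t j`, that mass is less than twice the tail of `c` at `s`.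
    · have hspec := Nat.find_spec hex
      have hsub : (M.filter fun ω => s < τ ω) ⊆ act (Nat.find hex) := by
        intro ω hω
        obtain ⟨j, hj, hωj, hsj⟩ := hτlt ω s hs (Finset.mem_filter.1 hω).2
        exact hanti _ _ (Nat.find_min' hex ⟨hj, hsj⟩) hωj
      have h1 := Finset.sum_le_sum_of_subset_of_nonneg (f := p) hsub
        fun ω hω _ => hp ω (hact _ hω)
      have h2 := htlt _ s hs hspec.2
      linarith
    · rw [Finset.filter_false_of_mem]
      · simpa using hnn
      · intro ω _ hlt
        obtain ⟨j, hj, _, hsj⟩ := hτlt ω s hs hlt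
        exact hex ⟨j, hj, hsj⟩
  have hstep : ∀ j ∈ Finset.range n, d j * ∑ ω ∈ act j, p ω ≤
      2 * K * ∑ ω ∈ M, p ω * (τ ω * if ω ∈ act j then g j ω else 0) := by
    intro j hj
    rw [Finset.mem_range] at hj
    have h1 := hgreedy j hj (t j) (ht0 j)
    have h2 : d j * ((∑ ω ∈ act j, p ω) / 2) ≤
        d j * (∑ ω ∈ act j, p ω - ∑ ω ∈ M with t j < c ω, p ω) :=
      mul_le_mul_of_nonneg_left (by linarith [htle j]) (hd j hj)
    have h3 : t j * ∑ ω ∈ act j, p ω * g j ω ≤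
        ∑ ω ∈ M, p ω * (τ ω * if ω ∈ act j then g j ω else 0) := by
      have h4 : ∑ ω ∈ M, p ω * (τ ω * if ω ∈ act j then g j ω else 0) =
          ∑ ω ∈ act j, p ω * (τ ω * g j ω) := by
        rw [← Finset.sum_subset (hact j)]
        · exact Finset.sum_congr rfl fun ω hω => by rw [if_pos hω]
        · intro ω _ hω
          rw [if_neg hω]; ring
      rw [h4, Finset.mul_sum]
      refine Finset.sum_le_sum fun ω hω => ?_
      have := mul_le_mul_of_nonneg_right (hτle ω j hj hω)
        (mul_nonneg (hp ω (hact j hω)) (hg j hj ω hω))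
      linarith
    have h5 := mul_le_mul_of_nonneg_left h3 hK
    linarith
  calc ∑ j ∈ Finset.range n, d j * ∑ ω ∈ act j, p ω
      ≤ ∑ j ∈ Finset.range n,
          2 * K * ∑ ω ∈ M, p ω * (τ ω * if ω ∈ act j then g j ω else 0) :=
        Finset.sum_le_sum hstep
    _ = 2 * K * ∑ ω ∈ M,
          p ω * (τ ω * ∑ j ∈ Finset.range n, if ω ∈ act j then g j ω else 0) := by
        rw [← Finset.mul_sum, Finset.sum_comm]
        simp_rw [Finset.mul_sum]
    _ ≤ 2 * K * ∑ ω ∈ M, p ω * (τ ω * L) := by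
        refine mul_le_mul_of_nonneg_left (Finset.sum_le_sum fun ω hω => ?_) (by positivity)
        exact mul_le_mul_of_nonneg_left (mul_le_mul_of_nonneg_left (hsum ω hω) (hτ0 ω)) (hp ω hω)
    _ = 2 * K * L * ∑ ω ∈ M, p ω * τ ω := by
        rw [Finset.mul_sum, Finset.mul_sum]
        exact Finset.sum_congr rfl fun ω _ => by ring
    _ ≤ 2 * K * L * (2 * ∑ ω ∈ M, p ω * c ω) :=
        mul_le_mul_of_nonneg_left htail (by positivity)
    _ = 4 * K * L * ∑ ω ∈ M, p ω * c ω := by ring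

/-- Potential bound for the relative decrease of a natural-valued sequence. -/
lemma sum_relative_decrease_le (F : ℕ → ℕ) (hF : ∀ j, F (j + 1) ≤ F j) (n : ℕ) :
    ∑ j ∈ Finset.range n, ((F j : ℝ) - F (j + 1)) / F j ≤ 1 + Real.log (F 0) := by
  -- The extra `1` pays for the final drop to `0`, whose relative decrease is exactly `1`. The other
  -- drops use `log x ≤ x - 1`.
  let Φ : ℕ → ℝ := fun a => if a = 0 then 0 else 1 + Real.log a
  have hΦ : ∀ a, 0 ≤ Φ a := by
    intro a
    simp only [Φ]
    split_ifs
    · exact le_rfl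
    · have := Real.log_natCast_nonneg a
      linarith
  have hstep : ∀ j, ((F j : ℝ) - F (j + 1)) / F j ≤ Φ (F j) - Φ (F (j + 1)) := by
    intro j
    have hle := hF j
    by_cases h0 : F j = 0
    · have h1 : F (j + 1) = 0 := by omega
      simp [Φ, h0, h1]
    have hpos : (0 : ℝ) < F j := by exact_mod_cast Nat.pos_of_ne_zero h0
    by_cases h1 : F (j + 1) = 0
    · have := Real.log_natCast_nonneg (F j)
      simp only [Φ, h1, h0, if_true, if_false, Nat.cast_zero, sub_zero, div_self hpos.ne']
      linarith
    · have hpos1 : (0 : ℝ) < F (j + 1) := by exact_mod_cast Nat.pos_of_ne_zero h1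
      have hlog := Real.log_le_sub_one_of_pos (div_pos hpos1 hpos)
      rw [Real.log_div hpos1.ne' hpos.ne'] at hlog
      simp only [Φ, h1, h0, if_false, sub_div, div_self hpos.ne']
      linarith
  have htel : ∑ j ∈ Finset.range n, ((F j : ℝ) - F (j + 1)) / F j ≤ Φ (F 0) - Φ (F n) :=
    (Finset.sum_le_sum fun j _ => hstep j).trans_eq (Finset.sum_range_sub' (fun j => Φ (F j)) n)
  have h0 : Φ (F 0) ≤ 1 + Real.log (F 0) := by
    simp only [Φ]
    split_ifs with h
    · simp [h]
    · exact le_rfl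
  linarith [hΦ (F n)]

/-- A nonincreasing sequence, starting at most at `m`, halves only a bounded number of times
while it is at least `δ * m`. -/
lemma sum_halving_le (z : ℕ → ℕ) (hz : ∀ j, z (j + 1) ≤ z j) (m : ℕ) (hm : 0 < m) (h0 : z 0 ≤ m)
    (δ : ℝ) (hδ : 0 < δ) (hδ1 : δ ≤ 1) (E : ℕ → Prop)
    (hE : ∀ j, E j → 2 * z (j + 1) ≤ z j ∧ δ * m ≤ z j) (n : ℕ) :
    ∑ j ∈ Finset.range n, (if E j then (1 : ℝ) else 0) ≤ Real.log (1 / δ) / Real.log 2 + 1 := by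
  have hm' : (0 : ℝ) < m := by exact_mod_cast hm
  -- The number of halvings so far is `c`. The last one started from at least `δ * m`, so `2 ^ (c -
  -- 1) ≤ 1 / δ`; this is the source of the final `+ 1`.
  have hinv : ∀ n, ∃ c : ℕ, ∑ j ∈ Finset.range n, (if E j then (1 : ℝ) else 0) = c ∧
      (2 : ℝ) ^ c * z n ≤ m ∧ (2 : ℝ) ^ c ≤ 2 * (1 / δ) := by
    intro n
    induction n with
    | zero =>
      refine ⟨0, by simp, by simpa using h0, ?_⟩
      have := one_le_one_div hδ hδ1
      simp only [pow_zero]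
      linarith
    | succ n ih =>
      obtain ⟨c, hc, h1, h2⟩ := ih
      rw [Finset.sum_range_succ, hc]
      by_cases h : E n
      · obtain ⟨h3, h4⟩ := hE n h
        have h3' : (2 : ℝ) * z (n + 1) ≤ z n := by exact_mod_cast h3
        refine ⟨c + 1, by simp [h], ?_, ?_⟩
        · calc (2 : ℝ) ^ (c + 1) * z (n + 1) = 2 ^ c * (2 * z (n + 1)) := by ring
            _ ≤ 2 ^ c * z n := by gcongr
            _ ≤ m := h1
        · have h5 : (2 : ℝ) ^ c * (δ * m) ≤ m := (by gcongr : (2 : ℝ) ^ c * (δ * m) ≤ _).trans h1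
          have h6 : (2 : ℝ) ^ c * δ ≤ 1 := by
            by_contra! hcon
            have := mul_lt_mul_of_pos_right hcon hm'
            linarith
          have h7 : (2 : ℝ) ^ c ≤ 1 / δ := by rwa [le_div_iff₀ hδ]
          rw [pow_succ]
          linarith
      · refine ⟨c, by simp [h], ?_, h2⟩
        refine le_trans ?_ h1
        have : (z (n + 1) : ℝ) ≤ z n := by exact_mod_cast hz n
        gcongr
  obtain ⟨c, hc, _, h2⟩ := hinv n
  have hl2 : 0 < Real.log 2 := Real.log_pos one_lt_two
  have hδ' : 0 < 1 / δ := by positivity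
  have h3 := Real.log_le_log (by positivity) h2
  rw [Real.log_pow, Real.log_mul two_ne_zero hδ'.ne'] at h3
  rw [hc, div_add_one hl2.ne', le_div_iff₀ hl2]
  linarith

end Accounting

/-! ### Ratio orienteering -/

section Orienteering

variable {V : Type*}

lemma IsMonoSubmodular.sum_mul {Ω : Type*} {X : Finset V} (s : Finset Ω) (p : Ω → ℝ)
    (g : Ω → Finset V → ℝ) (hp : ∀ ω ∈ s, 0 ≤ p ω) (hg : ∀ ω ∈ s, IsMonoSubmodular X (g ω)) :
    IsMonoSubmodular X fun T => ∑ ω ∈ s, p ω * g ω T where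
  empty := Finset.sum_eq_zero fun ω hω => by rw [(hg ω hω).empty, mul_zero]
  mono A B hAB hB := Finset.sum_le_sum fun ω hω =>
    mul_le_mul_of_nonneg_left ((hg ω hω).mono A B hAB hB) (hp ω hω)
  submod A B v hv hAB hB hvB := by
    rw [← Finset.sum_sub_distrib, ← Finset.sum_sub_distrib]
    refine Finset.sum_le_sum fun ω hω => ?_
    rw [← mul_sub, ← mul_sub]
    exact mul_le_mul_of_nonneg_left ((hg ω hω).submod A B v hv hAB hB hvB) (hp ω hω)

lemma IsMonoSubmodular.nonneg {X : Finset V} {g : Finset V → ℝ} (hg : IsMonoSubmodular X g)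
    {A : Finset V} (hA : A ⊆ X) : 0 ≤ g A :=
  hg.empty.ge.trans (hg.mono ∅ A (Finset.empty_subset _) hA)

lemma mul_tourLength_le_of_tourRatio_le [PseudoMetricSpace (Option V)] {g : Finset V → ℝ}
    {ρ : ℝ} (hρ : 0 ≤ ρ) {T T' : List V} (hT : 0 ≤ g T.toFinset)
    (h : tourRatio g T' ≤ ENNReal.ofReal ρ * tourRatio g T) :
    g T'.toFinset * tourLength (T.map some) ≤
      ρ * g T.toFinset * tourLength (T'.map some) := by
  have hd := tourLength_nonneg (T.map some)
  have hd' := tourLength_nonneg (T'.map some)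
  unfold tourRatio at h
  set d := tourLength (T.map some)
  set d' := tourLength (T'.map some)
  rcases hd.eq_or_lt with hd0 | hdpos
  · rw [← hd0, mul_zero]
    positivity
  rw [← ENNReal.ofReal_div_of_pos hdpos, ← ENNReal.ofReal_mul hρ] at h
  rcases hd'.eq_or_lt with hd0 | hdpos'
  · rw [← hd0, mul_zero]
    -- A tour of length zero with positive gain would have ratio `∞`, above the finite ratio of `T`.
    refine mul_nonpos_of_nonpos_of_nonneg ?_ hd
    by_contra! hpos
    rw [← hd0, ENNReal.ofReal_zero, ENNReal.div_zero (by simpa using hpos)] at h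
    exact absurd h (not_le.2 ENNReal.ofReal_lt_top)
  · rw [← ENNReal.ofReal_div_of_pos hdpos',
      ENNReal.ofReal_le_ofReal_iff (by positivity), ← mul_div_assoc, div_le_div_iff₀ hdpos' hdpos]
      at h
    exact h

end Orienteering

/-! ### Adaptive policies -/

namespace AdaptivePolicy

variable {V Ω O : Type*}

lemma map_some_reduceOption_walk (π : AdaptivePolicy V O) (o : V → O) :
    (π.walk o).reduceOption.map some = π.walk o := by
  induction π with
  | halt => rfl
  | visit v next ih =>
    simp only [walk, List.reduceOption_cons_of_some, List.map_cons, ih]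

/-- Among the scenarios of `W` there is one whose walk follows the branches `b` longest: every other
scenario either shows something else than `b` on that walk, or makes the same walk. -/
lemma exists_longest_stem (π : AdaptivePolicy V O) (obs : Ω → V → O) (b : V → O)
    (W : Finset Ω) (hW : W.Nonempty) :
    ∃ ω₀ ∈ W, ∀ ω ∈ W, (∃ v, some v ∈ π.walk (obs ω₀) ∧ obs ω v ≠ b v) ∨
      π.walk (obs ω) = π.walk (obs ω₀) := by
  induction π generalizing W with
  | halt =>
    obtain ⟨ω₀, h⟩ := hW
    exact ⟨ω₀, h, fun ω _ => Or.inr rfl⟩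
  | visit v next ih =>
    -- If some scenarios take the branch `b v`, the stem is chosen among them and all others leave
    -- it at `v`. Otherwise any scenario serves, as all deviate at `v`.
    by_cases hne : (W.filter fun ω => obs ω v = b v).Nonempty
    · obtain ⟨ω₀, h₀, h⟩ := ih (b v) _ hne
      rw [Finset.mem_filter] at h₀
      refine ⟨ω₀, h₀.1, fun ω hω => ?_⟩
      by_cases hv : obs ω v = b v
      · simp only [walk, h₀.2, hv, List.mem_cons]
        rcases h ω (Finset.mem_filter.2 ⟨hω, hv⟩) with ⟨u, hu, hub⟩ | heq
        · exact Or.inl ⟨u, Or.inr hu, hub⟩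
        · exact Or.inr (by rw [heq])
      · exact Or.inl ⟨v, by simp [walk], hv⟩
    · obtain ⟨ω₀, h⟩ := hW
      refine ⟨ω₀, h, fun ω hω => Or.inl ⟨v, by simp [walk], fun hv => hne ?_⟩⟩
      exact ⟨ω, Finset.mem_filter.2 ⟨hω, hv⟩⟩

/-- The policy that skips the locations whose observation is already recorded in `ψ`. -/
noncomputable def prune (ψ : Finset (V × O)) : AdaptivePolicy V O → AdaptivePolicy V O
  | .halt => .halt
  | .visit v next =>
    -- When `ψ` agrees with the true observations, the recorded value is unique, so the choice
    -- follows the true branch.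
    if h : ∃ x, (v, x) ∈ ψ then (next h.choose).prune ψ
    else .visit v fun x => (next x).prune ψ

lemma prune_walk (ψ : Finset (V × O)) (o : V → O) (ho : ∀ e ∈ ψ, o e.1 = e.2)
    (π : AdaptivePolicy V O) :
    ((π.prune ψ).walk o).Sublist (π.walk o) ∧
      ∀ v, some v ∈ (π.prune ψ).walk o ↔ some v ∈ π.walk o ∧ ¬ ∃ x, (v, x) ∈ ψ := by
  induction π with
  | halt => simp [prune, walk]
  | visit v next ih =>
    by_cases h : ∃ x, (v, x) ∈ ψ
    · have hv : h.choose = o v := (ho _ h.choose_spec).symm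
      have heq : (prune ψ (.visit v next)) = (next (o v)).prune ψ := by
        rw [prune, dif_pos h, hv]
      rw [heq]
      obtain ⟨h1, h2⟩ := ih (o v)
      refine ⟨h1.cons _, fun u => ?_⟩
      rw [h2 u]
      simp only [walk, List.mem_cons, Option.some.injEq]
      constructor
      · rintro ⟨ha, hb⟩
        exact ⟨Or.inr ha, hb⟩
      · rintro ⟨rfl | ha, hb⟩
        · exact absurd h hb
        · exact ⟨ha, hb⟩
    · have heq : (prune ψ (.visit v next)) = .visit v fun x => (next x).prune ψ := by
        rw [prune, dif_neg h]
      rw [heq]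
      obtain ⟨h1, h2⟩ := ih (o v)
      refine ⟨h1.cons_cons _, fun u => ?_⟩
      simp only [walk, List.mem_cons, Option.some.injEq, h2 u]
      constructor
      · rintro (rfl | ha)
        · exact ⟨Or.inl rfl, h⟩
        · exact ⟨Or.inr ha.1, ha.2⟩
      · rintro ⟨rfl | ha, hb⟩
        · exact Or.inl rfl
        · exact Or.inr ⟨ha, hb⟩

end AdaptivePolicy

namespace IPP

variable {V Ω O : Type*}

/-! ### Parts and active scenarios -/

/-- The scenarios that agree with `ω` on `S`. -/
noncomputable def part (I : IPP V Ω O) (S : Finset V) (ω : Ω) : Finset Ω :=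
  I.M.filter fun ω' => ∀ v ∈ S, I.obs ω' v = I.obs ω v

/-- The scenarios to which the stopping rule does not apply when `S` has been visited. -/
noncomputable def activeScenarios (I : IPP V Ω O) (δ : ℝ) (S : Finset V) : Finset Ω :=
  I.M.filter fun ω => ¬ I.stopRule δ (realization (I.obs ω) S)

variable {I : IPP V Ω O}

lemma mem_part {S : Finset V} {ω ω' : Ω} :
    ω' ∈ I.part S ω ↔ ω' ∈ I.M ∧ ∀ v ∈ S, I.obs ω' v = I.obs ω v :=
  Finset.mem_filter

lemma mem_part_self {S : Finset V} {ω : Ω} (h : ω ∈ I.M) : ω ∈ I.part S ω :=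
  mem_part.2 ⟨h, fun _ _ => rfl⟩

lemma part_subset (S : Finset V) (ω : Ω) : I.part S ω ⊆ I.M :=
  Finset.filter_subset _ _

lemma part_eq_of_mem {S : Finset V} {ω ω' : Ω} (h : ω' ∈ I.part S ω) :
    I.part S ω' = I.part S ω :=
  Finset.filter_congr fun _ _ =>
    forall₂_congr fun v hv => by rw [(mem_part.1 h).2 v hv]

lemma part_anti {S T : Finset V} (h : S ⊆ T) (ω : Ω) : I.part T ω ⊆ I.part S ω :=
  fun _ hω => mem_part.2 ⟨(mem_part.1 hω).1, fun v hv => (mem_part.1 hω).2 v (h hv)⟩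

lemma mem_compatible {ψ : Finset (V × O)} {ω : Ω} :
    ω ∈ I.compatible ψ ↔ ω ∈ I.M ∧ ∀ e ∈ ψ, I.obs ω e.1 = e.2 :=
  Finset.mem_filter

lemma compatible_realization (S : Finset V) (ω : Ω) :
    I.compatible (realization (I.obs ω) S) = I.part S ω := by
  ext ω'
  rw [mem_compatible, mem_part]
  simp [realization]

lemma realization_eq_of_mem_part {S : Finset V} {ω ω' : Ω} (h : ω' ∈ I.part S ω) :
    realization (I.obs ω') S = realization (I.obs ω) S :=
  realization_congr (mem_part.1 h).2

lemma mem_activeScenarios {δ : ℝ} {S : Finset V} {ω : Ω} :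
    ω ∈ I.activeScenarios δ S ↔ ω ∈ I.M ∧ δ * (I.M.card : ℝ) ≤ ((I.part S ω).card : ℝ) ∧
      I.f (realization (I.obs ω) S) < I.Q := by
  rw [activeScenarios, Finset.mem_filter, stopRule, not_not, compatible_realization]

lemma activeScenarios_subset (δ : ℝ) (S : Finset V) : I.activeScenarios δ S ⊆ I.M :=
  Finset.filter_subset _ _

lemma mem_activeScenarios_of_mem_part {δ : ℝ} {S : Finset V} {ω ω' : Ω}
    (h : ω' ∈ I.part S ω) (hω : ω ∈ I.activeScenarios δ S) : ω' ∈ I.activeScenarios δ S := by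
  rw [mem_activeScenarios] at hω ⊢
  rw [part_eq_of_mem h, realization_eq_of_mem_part h]
  exact ⟨(mem_part.1 h).1, hω.2⟩

lemma mem_activeParts {δ : ℝ} {S : Finset V} {Z : Finset Ω} :
    Z ∈ I.activeParts δ S ↔ ∃ ω ∈ I.activeScenarios δ S, I.part S ω = Z := by
  rw [activeParts, Finset.mem_filter, parts, Finset.mem_image]
  constructor
  · rintro ⟨⟨ω, hω, rfl⟩, h1, h2⟩
    exact ⟨ω, mem_activeScenarios.2 ⟨hω, h1, h2 ω (mem_part_self hω)⟩, rfl⟩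
  · rintro ⟨ω, hω, rfl⟩
    rw [mem_activeScenarios] at hω
    refine ⟨⟨ω, hω.1, rfl⟩, hω.2.1, fun ω' hω' => ?_⟩
    rw [realization_eq_of_mem_part hω']
    exact hω.2.2

lemma activeParts_eq_empty_iff {δ : ℝ} {S : Finset V} :
    I.activeParts δ S = ∅ ↔ I.activeScenarios δ S = ∅ := by
  simp only [Finset.eq_empty_iff_forall_notMem, mem_activeParts]
  constructor
  · intro h ω hω
    exact h _ ⟨ω, hω, rfl⟩
  · rintro h Z ⟨ω, hω, -⟩
    exact h ω hω

/-- The active parts partition the active scenarios. This turns the score of a tour into an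
expectation over scenarios. -/
lemma sum_activeParts (δ : ℝ) (S : Finset V) (h : Finset Ω → Ω → ℝ) :
    ∑ Z ∈ I.activeParts δ S, ∑ ω ∈ Z, h Z ω =
      ∑ ω ∈ I.activeScenarios δ S, h (I.part S ω) ω := by
  rw [← Finset.sum_fiberwise_of_maps_to (s := I.activeScenarios δ S) (t := I.activeParts δ S)
    (g := fun ω => I.part S ω) fun ω hω => mem_activeParts.2 ⟨ω, hω, rfl⟩]
  refine Finset.sum_congr rfl fun Z hZ => ?_
  obtain ⟨ω₀, h₀, rfl⟩ := mem_activeParts.1 hZ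
  have : (I.activeScenarios δ S).filter (fun ω => I.part S ω = I.part S ω₀) = I.part S ω₀ := by
    ext ω
    rw [Finset.mem_filter]
    constructor
    · rintro ⟨h1, h2⟩
      rw [← h2]
      exact mem_part_self (activeScenarios_subset _ _ h1)
    · intro hω
      exact ⟨mem_activeScenarios_of_mem_part hω h₀, part_eq_of_mem hω⟩
  rw [this]
  exact Finset.sum_congr rfl fun ω hω => by rw [part_eq_of_mem hω]

/-- Active parts are disjoint and each contains at least `δ * |M|` scenarios. This is where the
factor `1 / δ` comes from. -/
lemma card_activeParts_mul_le {δ : ℝ} (S : Finset V) (hM : I.M.Nonempty) :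
    ((I.activeParts δ S).card : ℝ) * δ ≤ 1 := by
  have hm : (0 : ℝ) < I.M.card := by exact_mod_cast hM.card_pos
  have h1 : ∑ Z ∈ I.activeParts δ S, (Z.card : ℝ) = (I.activeScenarios δ S).card := by
    have := I.sum_activeParts δ S fun _ _ => (1 : ℝ)
    simpa using this
  have h2 : ((I.activeParts δ S).card : ℝ) * (δ * I.M.card) ≤
      ∑ Z ∈ I.activeParts δ S, (Z.card : ℝ) := by
    rw [← nsmul_eq_mul]
    exact Finset.card_nsmul_le_sum _ _ _ fun Z hZ => (Finset.mem_filter.1 hZ).2.1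
  have h3 : ((I.activeScenarios δ S).card : ℝ) ≤ I.M.card := by
    exact_mod_cast Finset.card_le_card (activeScenarios_subset _ _)
  refine le_of_mul_le_mul_right ?_ hm
  linarith

/-! ### Validity -/

lemma IsValid.nonempty (hI : I.IsValid) : I.M.Nonempty := by
  rw [Finset.nonempty_iff_ne_empty]
  intro h
  have := hI.p_sum
  simp [h] at this

lemma IsValid.p_nonneg (hI : I.IsValid) {ω : Ω} (hω : ω ∈ I.M) : 0 ≤ I.p ω :=
  (hI.p_pos ω hω).le

lemma fst_mem_of_mem_realization {o : V → O} {S X : Finset V} (h : S ⊆ X) :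
    ∀ e ∈ realization o S, e.1 ∈ X :=
  fun _ he => h (mem_realization.1 he).1

lemma fst_mem_union {X : Finset V} {A B : Finset (V × O)} (hA : ∀ e ∈ A, e.1 ∈ X)
    (hB : ∀ e ∈ B, e.1 ∈ X) : ∀ e ∈ A ∪ B, e.1 ∈ X := fun e he =>
  (Finset.mem_union.1 he).elim (hA e) (hB e)

/-- When `e ∈ B`, submodularity reduces to monotonicity, so the side condition `e ∉ B` can be
dropped. -/
lemma IsValid.f_insert_add_le (hI : I.IsValid) {A B : Finset (V × O)} {e : V × O} (hAB : A ⊆ B)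
    (hB : ∀ e' ∈ B, e'.1 ∈ I.X) (he : e.1 ∈ I.X) :
    I.f (insert e B) + I.f A ≤ I.f (insert e A) + I.f B := by
  by_cases heB : e ∈ B
  · rw [Finset.insert_eq_of_mem heB, add_comm]
    refine Nat.add_le_add_right (hI.mono A _ (Finset.subset_insert _ _) fun e' he' => ?_) _
    rcases Finset.mem_insert.1 he' with rfl | h
    · exact he
    · exact hB _ (hAB h)
  · exact hI.submod A B e hAB hB he heB

lemma IsValid.f_realization_le (hI : I.IsValid) (o : V → O) {S T : Finset V} (h : S ⊆ T)
    (hT : T ⊆ I.X) : I.f (realization o S) ≤ I.f (realization o T) :=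
  hI.mono _ _ (realization_mono o h) (fst_mem_of_mem_realization hT)

lemma activeScenarios_anti (hI : I.IsValid) (δ : ℝ) {S T : Finset V} (h : S ⊆ T)
    (hT : T ⊆ I.X) : I.activeScenarios δ T ⊆ I.activeScenarios δ S := by
  intro ω hω
  rw [mem_activeScenarios] at hω ⊢
  refine ⟨hω.1, hω.2.1.trans ?_, (hI.f_realization_le _ h hT).trans_lt hω.2.2⟩
  exact_mod_cast Finset.card_le_card (part_anti h ω)

/-! ### The gain of a tour, scenario by scenario -/

/-- The contribution of the scenario `ω` to the score of a tour with locations `T`, after `S`. -/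
noncomputable def scenarioGain (I : IPP V Ω O) (B : V → Finset Ω → Finset Ω) (S : Finset V) (ω : Ω)
    (T : Finset V) : ℝ :=
  (if ∃ v ∈ T, ω ∉ B v (I.part S ω) then 1 else 0) +
    ((I.f (realization (I.obs ω) (S ∪ T)) : ℝ) - I.f (realization (I.obs ω) S)) /
      ((I.Q : ℝ) - I.f (realization (I.obs ω) S))

lemma gain_eq_sum (I : IPP V Ω O) (B : V → Finset Ω → Finset Ω) (δ : ℝ) (S T : Finset V) :
    I.gain B δ S T = ∑ ω ∈ I.activeScenarios δ S, I.p ω * I.scenarioGain B S ω T := by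
  refine Eq.trans ?_ (I.sum_activeParts δ S fun Z ω => I.p ω *
    ((if ∃ v ∈ T, ω ∉ B v Z then (1 : ℝ) else 0) +
    ((I.f (realization (I.obs ω) (S ∪ T)) : ℝ) - I.f (realization (I.obs ω) S)) /
      ((I.Q : ℝ) - I.f (realization (I.obs ω) S))))
  refine Finset.sum_congr rfl fun Z _ => ?_
  simp_rw [mul_add, Finset.sum_add_distrib, realization_union]
  congr 1
  have : (T.biUnion fun v => Z \ B v Z) = Z.filter fun ω => ∃ v ∈ T, ω ∉ B v Z := by
    ext ω
    simp only [Finset.mem_biUnion, Finset.mem_sdiff, Finset.mem_filter]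
    constructor
    · rintro ⟨v, hv, h1, h2⟩
      exact ⟨h1, v, hv, h2⟩
    · rintro ⟨h1, v, hv, h2⟩
      exact ⟨v, hv, h1, h2⟩
  rw [this, Finset.sum_filter]
  exact Finset.sum_congr rfl fun ω _ => by split_ifs <;> simp

/-- The first term indicates that `T` meets a fixed set. The second is a nonnegative multiple of a
contraction of `f`; if the target is already reached, Lean's division by zero makes it `0`. -/
lemma isMonoSubmodular_scenarioGain (hI : I.IsValid) (B : V → Finset Ω → Finset Ω)
    {S : Finset V} (hS : S ⊆ I.X) (ω : Ω) :
    IsMonoSubmodular I.X (I.scenarioGain B S ω) := by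
  have hQ : (0 : ℝ) ≤ (I.Q : ℝ) - I.f (realization (I.obs ω) S) :=
    sub_nonneg.2 (by exact_mod_cast hI.le_Q _ (fst_mem_of_mem_realization hS))
  have hmono : ∀ A B' : Finset V, A ⊆ B' → B' ⊆ I.X →
      I.scenarioGain B S ω A ≤ I.scenarioGain B S ω B' := by
    intro A B' hAB hB
    have hf : (I.f (realization (I.obs ω) (S ∪ A)) : ℝ) ≤
        I.f (realization (I.obs ω) (S ∪ B')) := by
      exact_mod_cast hI.f_realization_le _ (Finset.union_subset_union_right hAB)
        (Finset.union_subset hS hB)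
    unfold scenarioGain
    refine add_le_add ?_ (div_le_div_of_nonneg_right (by linarith) hQ)
    by_cases hA : ∃ v ∈ A, ω ∉ B v (I.part S ω)
    · rw [if_pos hA, if_pos]
      obtain ⟨v, hv, h⟩ := hA
      exact ⟨v, hAB hv, h⟩
    · rw [if_neg hA]
      split_ifs <;> norm_num
  refine ⟨by simp [scenarioGain], hmono, ?_⟩
  intro A B' v hv hAB hB hvB
  have hsub := hI.f_insert_add_le (e := (v, I.obs ω v))
    (realization_mono (I.obs ω) (Finset.union_subset_union_right (s := S) hAB))
    (fst_mem_of_mem_realization (Finset.union_subset hS hB)) hv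
  have hins : ∀ T : Finset V, realization (I.obs ω) (S ∪ insert v T) =
      insert (v, I.obs ω v) (realization (I.obs ω) (S ∪ T)) := by
    intro T
    rw [Finset.union_insert, realization, Finset.image_insert]
    rfl
  rw [← hins, ← hins] at hsub
  have hsub' : (I.f (realization (I.obs ω) (S ∪ insert v B')) : ℝ) +
      I.f (realization (I.obs ω) (S ∪ A)) ≤ I.f (realization (I.obs ω) (S ∪ insert v A)) +
      I.f (realization (I.obs ω) (S ∪ B')) := by exact_mod_cast hsub
  have hrel : ∀ a b c d q s : ℝ, 0 ≤ q → a + d ≤ c + b →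
      (a - s) / q - (b - s) / q ≤ (c - s) / q - (d - s) / q := by
    intro a b c d q s hq h
    rw [← sub_div, ← sub_div]
    exact div_le_div_of_nonneg_right (by linarith) hq
  have h2 := hrel _ _ _ _ _ (I.f (realization (I.obs ω) S) : ℝ) hQ hsub'
  have h1 : (if ∃ u ∈ insert v B', ω ∉ B u (I.part S ω) then (1 : ℝ) else 0) -
      (if ∃ u ∈ B', ω ∉ B u (I.part S ω) then (1 : ℝ) else 0) ≤
      (if ∃ u ∈ insert v A, ω ∉ B u (I.part S ω) then (1 : ℝ) else 0) -
      (if ∃ u ∈ A, ω ∉ B u (I.part S ω) then (1 : ℝ) else 0) := by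
    have hAB' : (∃ u ∈ A, ω ∉ B u (I.part S ω)) → ∃ u ∈ B', ω ∉ B u (I.part S ω) :=
      fun ⟨u, hu, h⟩ => ⟨u, hAB hu, h⟩
    simp only [Finset.exists_mem_insert]
    by_cases ha : ∃ u ∈ A, ω ∉ B u (I.part S ω)
    · simp [ha, hAB' ha]
    · by_cases hb : ∃ u ∈ B', ω ∉ B u (I.part S ω)
      · simp only [hb, ha, or_true, or_false, if_true, if_false]
        split_ifs <;> norm_num
      · simp [ha, hb]
  unfold scenarioGain
  linarith

lemma isMonoSubmodular_gain (hI : I.IsValid) (B : V → Finset Ω → Finset Ω) (δ : ℝ)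
    {S : Finset V} (hS : S ⊆ I.X) : IsMonoSubmodular I.X (I.gain B δ S) := by
  have : I.gain B δ S =
      fun T => ∑ ω ∈ I.activeScenarios δ S, I.p ω * I.scenarioGain B S ω T :=
    funext fun T => I.gain_eq_sum B δ S T
  rw [this]
  exact IsMonoSubmodular.sum_mul _ _ _
    (fun ω hω => hI.p_nonneg (activeScenarios_subset _ _ hω))
    fun ω _ => isMonoSubmodular_scenarioGain hI B hS ω

lemma one_le_scenarioGain (hI : I.IsValid) {B : V → Finset Ω → Finset Ω} {S : Finset V}
    (hS : S ⊆ I.X) {T : Finset V} (hT : T ⊆ I.X) {ω : Ω}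
    (hω : I.f (realization (I.obs ω) S) < I.Q)
    (h : (∃ v ∈ T, ω ∉ B v (I.part S ω)) ∨ I.f (realization (I.obs ω) T) = I.Q) :
    1 ≤ I.scenarioGain B S ω T := by
  have hQ : (0 : ℝ) < (I.Q : ℝ) - I.f (realization (I.obs ω) S) :=
    sub_pos.2 (by exact_mod_cast hω)
  have hf : (I.f (realization (I.obs ω) S) : ℝ) ≤ I.f (realization (I.obs ω) (S ∪ T)) := by
    exact_mod_cast hI.f_realization_le _ Finset.subset_union_left (Finset.union_subset hS hT)
  unfold scenarioGain
  rcases h with h | h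
  · rw [if_pos h]
    have := div_nonneg (sub_nonneg.2 hf) hQ.le
    linarith
  · have hf' : (I.Q : ℝ) ≤ I.f (realization (I.obs ω) (S ∪ T)) := by
      rw [← h]
      exact_mod_cast hI.f_realization_le _ Finset.subset_union_right (Finset.union_subset hS hT)
    have : 1 ≤ ((I.f (realization (I.obs ω) (S ∪ T)) : ℝ) - I.f (realization (I.obs ω) S)) /
        ((I.Q : ℝ) - I.f (realization (I.obs ω) S)) := by
      rw [one_le_div hQ]
      linarith
    split_ifs <;> linarith

lemma exists_isLargestPart (I : IPP V Ω O) : ∃ B, I.IsLargestPart B := by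
  have : ∀ (v : V) (Z : Finset Ω), ∃ P : Finset Ω, Z.Nonempty →
      (∃ ω ∈ Z, P = I.partAt v Z ω) ∧ ∀ ω ∈ Z, (I.partAt v Z ω).card ≤ P.card := by
    intro v Z
    by_cases hZ : Z.Nonempty
    · obtain ⟨ω, hω, hmax⟩ := Finset.exists_max_image Z (fun ω => (I.partAt v Z ω).card) hZ
      exact ⟨I.partAt v Z ω, fun _ => ⟨⟨ω, hω, rfl⟩, hmax⟩⟩
    · exact ⟨∅, fun h => absurd h hZ⟩
  choose B hB using this
  exact ⟨B, fun v _ Z _ hZ => hB v Z hZ⟩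

/-- Scenarios outside the largest part see their part halved. -/
lemma two_mul_card_part_le {B : V → Finset Ω → Finset Ω} (hB : I.IsLargestPart B)
    {S T : Finset V} {ω : Ω} (hω : ω ∈ I.M) {v : V} (hvX : v ∈ I.X) (hv : v ∈ T)
    (h : ω ∉ B v (I.part S ω)) :
    2 * (I.part (S ∪ T) ω).card ≤ (I.part S ω).card := by
  obtain ⟨⟨ω₀, h₀, hB₀⟩, hmax⟩ := hB v hvX (I.part S ω) (part_subset _ _) ⟨ω, mem_part_self hω⟩
  have hne : I.obs ω v ≠ I.obs ω₀ v := by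
    intro heq
    apply h
    rw [hB₀]
    exact Finset.mem_filter.2 ⟨mem_part_self hω, heq⟩
  have hsub : I.part (S ∪ T) ω ⊆ I.partAt v (I.part S ω) ω := fun ω' hω' =>
    Finset.mem_filter.2 ⟨part_anti Finset.subset_union_left ω hω',
      (mem_part.1 hω').2 v (Finset.mem_union_right _ hv)⟩
  have hdisj : Disjoint (I.partAt v (I.part S ω) ω) (B v (I.part S ω)) := by
    rw [hB₀, Finset.disjoint_left]
    intro ω' h1 h2
    exact hne ((Finset.mem_filter.1 h1).2.symm.trans (Finset.mem_filter.1 h2).2)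
  have hcard : (I.partAt v (I.part S ω) ω).card + (B v (I.part S ω)).card ≤
      (I.part S ω).card := by
    rw [← Finset.card_union_of_disjoint hdisj]
    refine Finset.card_le_card (Finset.union_subset (Finset.filter_subset _ _) ?_)
    rw [hB₀]
    exact Finset.filter_subset _ _
  have h1 := Finset.card_le_card hsub
  have h2 := hmax ω (mem_part_self hω)
  omega

/-- Comparison tour: the walks of an adaptive solution of cost at most `t`, one per active part. -/
lemma exists_tour_gain_ge [PseudoMetricSpace (Option V)] (hI : I.IsValid)
    {B : V → Finset Ω → Finset Ω} (hB : I.IsLargestPart B) {δ : ℝ} (hδ : 0 < δ)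
    {S : Finset V} (hS : S ⊆ I.X) (π : AdaptivePolicy V O)
    (hπ : I.Covers fun ω => π.walk (I.obs ω)) {t : ℝ} (ht : 0 ≤ t) :
    ∃ T : List V, (∀ v ∈ T, v ∈ I.X) ∧ tourLength (T.map some) ≤ t / δ ∧
      ∑ ω ∈ I.activeScenarios δ S, I.p ω -
        ∑ ω ∈ I.M with t < tourLength (π.walk (I.obs ω)), I.p ω ≤ I.gain B δ S T.toFinset := by
  have hZ : ∀ Z ∈ I.activeParts δ S, ∃ T : List V, (∀ v ∈ T, v ∈ I.X) ∧
      tourLength (T.map some) ≤ t ∧ ∀ ω ∈ Z, tourLength (π.walk (I.obs ω)) ≤ t →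
        (∃ v ∈ T, ω ∉ B v Z) ∨ ∀ v, some v ∈ π.walk (I.obs ω) → v ∈ T := by
    intro Z hZ
    obtain ⟨ω₁, h₁, rfl⟩ := mem_activeParts.1 hZ
    have h₁M := activeScenarios_subset _ _ h₁
    by_cases hW : ((I.part S ω₁).filter fun ω => tourLength (π.walk (I.obs ω)) ≤ t).Nonempty
    -- The branch `b v` is the observation common to the largest class at `v`. Deviating from it
    -- means lying outside that class.
    · have hb : ∀ v, ∃ x : O, v ∈ I.X →
          ∀ ω ∈ B v (I.part S ω₁), I.obs ω v = x := by
        intro v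
        by_cases hv : v ∈ I.X
        · obtain ⟨⟨ω₀, h₀, hB₀⟩, -⟩ :=
            hB v hv (I.part S ω₁) (part_subset _ _) ⟨ω₁, mem_part_self h₁M⟩
          refine ⟨I.obs ω₀ v, fun _ ω hω => ?_⟩
          rw [hB₀] at hω
          exact (Finset.mem_filter.1 hω).2
        · exact ⟨I.obs ω₁ v, fun h => absurd h hv⟩
      choose b hb using hb
      obtain ⟨ω₀, h₀, hstem⟩ := π.exists_longest_stem I.obs b _ hW
      rw [Finset.mem_filter] at h₀
      have hX := (hπ ω₀ (part_subset _ _ h₀.1)).1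
      refine ⟨(π.walk (I.obs ω₀)).reduceOption, ?_, ?_, ?_⟩
      · intro v hv
        exact hX v (List.reduceOption_mem_iff.1 hv)
      · rw [AdaptivePolicy.map_some_reduceOption_walk]
        exact h₀.2
      · intro ω hω hωt
        rcases hstem ω (Finset.mem_filter.2 ⟨hω, hωt⟩) with ⟨v, hv, hne⟩ | heq
        · exact Or.inl ⟨v, List.reduceOption_mem_iff.2 hv, fun hmem => hne (hb v (hX v hv) ω hmem)⟩
        · right
          intro v hv
          rw [heq] at hv
          exact List.reduceOption_mem_iff.2 hv
    · refine ⟨[], by simp, by simpa [tourLength_nil] using ht, fun ω hω hωt => ?_⟩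
      exact absurd ⟨ω, Finset.mem_filter.2 ⟨hω, hωt⟩⟩ hW
  choose! T hTX hTlen hT using hZ
  have hTX' : ∀ v ∈ (I.activeParts δ S).toList.flatMap T, v ∈ I.X := by
    intro v hv
    obtain ⟨Z, hZ, hvZ⟩ := List.mem_flatMap.1 hv
    exact hTX Z (Finset.mem_toList.1 hZ) v hvZ
  refine ⟨(I.activeParts δ S).toList.flatMap T, hTX', ?_, ?_⟩
  · rw [List.map_flatMap]
    refine (tourLength_flatMap_le _ _).trans ?_
    rw [Finset.sum_map_toList]
    refine (Finset.sum_le_card_nsmul _ _ t hTlen).trans ?_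
    -- At most `1 / δ` walks are joined, each of length at most `t`.
    rw [nsmul_eq_mul, le_div_iff₀ hδ]
    have := mul_le_mul_of_nonneg_right (card_activeParts_mul_le (δ := δ) S hI.nonempty) ht
    linarith
  · rw [gain_eq_sum]
    have hTX'' : (((I.activeParts δ S).toList.flatMap T).toFinset) ⊆ I.X := fun v hv =>
      hTX' v (List.mem_toFinset.1 hv)
    set U := ((I.activeParts δ S).toList.flatMap T).toFinset with hU
    have hmemU : ∀ ω ∈ I.activeScenarios δ S, ∀ v ∈ T (I.part S ω), v ∈ U := by
      intro ω hω v hv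
      exact List.mem_toFinset.2 (List.mem_flatMap.2
        ⟨_, Finset.mem_toList.2 (mem_activeParts.2 ⟨ω, hω, rfl⟩), hv⟩)
    have hone : ∀ ω ∈ I.activeScenarios δ S, tourLength (π.walk (I.obs ω)) ≤ t →
        1 ≤ I.scenarioGain B S ω U := by
      intro ω hω hωt
      have hωM := activeScenarios_subset _ _ hω
      refine one_le_scenarioGain hI hS hTX'' (mem_activeScenarios.1 hω).2.2 ?_
      rcases hT _ (mem_activeParts.2 ⟨ω, hω, rfl⟩) ω (mem_part_self hωM) hωt with
        ⟨v, hv, h⟩ | h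
      · exact Or.inl ⟨v, hmemU ω hω v hv, h⟩
      · right
        refine le_antisymm (hI.le_Q _ (fst_mem_of_mem_realization hTX'')) ?_
        rw [← (hπ ω hωM).2]
        refine hI.mono _ _ (fun e he => ?_) (fst_mem_of_mem_realization hTX'')
        rw [mem_sensed] at he
        exact mem_realization.2 ⟨hmemU ω hω _ (h _ he.1), he.2⟩
    -- Scenarios of cost above `t` may gain nothing; nonnegativity of their gain suffices.
    have hlow : ∀ ω ∈ I.activeScenarios δ S,
        I.p ω - (if t < tourLength (π.walk (I.obs ω)) then I.p ω else 0) ≤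
          I.p ω * I.scenarioGain B S ω U := by
      intro ω hω
      have hp := hI.p_nonneg (activeScenarios_subset _ _ hω)
      split_ifs with h
      · rw [sub_self]
        exact mul_nonneg hp ((isMonoSubmodular_scenarioGain hI B hS ω).nonneg hTX'')
      · rw [sub_zero]
        exact le_mul_of_one_le_right hp (hone ω hω (not_lt.1 h))
    refine le_trans ?_ (Finset.sum_le_sum hlow)
    rw [Finset.sum_sub_distrib, Finset.sum_filter]
    refine sub_le_sub_left ?_ _
    refine Finset.sum_le_sum_of_subset_of_nonneg (activeScenarios_subset _ _) fun ω hω _ => ?_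
    split_ifs
    · exact hI.p_nonneg hω
    · exact le_rfl

end IPP

namespace IPP

variable {V Ω O : Type*} {I : IPP V Ω O}

/-! ### The planning loop -/

/-- The locations visited after the first `j` tours of the list `Ts`, starting from `S`. -/
noncomputable def visited (S : Finset V) (Ts : List (List V)) : ℕ → Finset V
  | 0 => S
  -- Past the end of `Ts` the default `[]` keeps the set constant.
  | j + 1 => visited S Ts j ∪ (Ts.getD j []).toFinset

lemma visited_cons_succ (S : Finset V) (T : List V) (Ts : List (List V)) (j : ℕ) :
    visited S (T :: Ts) (j + 1) = visited (S ∪ T.toFinset) Ts j := by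
  induction j with
  | zero => simp [visited]
  | succ j ih =>
    rw [visited, ih]
    simp [visited]

lemma visited_mono (S : Finset V) (Ts : List (List V)) : Monotone (visited S Ts) :=
  monotone_nat_of_le_succ fun _ => Finset.subset_union_left

section

variable {A : Finset V → (Finset V → ℝ) → List V → Prop} {δ : ℝ}

lemma Plan.getD_spec {S : Finset V} {Ts : List (List V)} (h : I.Plan A δ S Ts) :
    ∀ j < Ts.length, I.activeParts δ (visited S Ts j) ≠ ∅ ∧ ∃ B, I.IsLargestPart B ∧
      A I.X (I.gain B δ (visited S Ts j)) (Ts.getD j []) := by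
  induction h with
  | finish S h => simp
  | select S B T Ts hS hZ hB hT hTs ih =>
    intro j hj
    cases j with
    | zero => exact ⟨hZ, B, hB, by simpa [visited] using hT⟩
    | succ j =>
      rw [visited_cons_succ]
      simpa using ih j (by simpa using hj)

lemma Plan.finish_spec {S : Finset V} {Ts : List (List V)} (h : I.Plan A δ S Ts) :
    visited S Ts Ts.length = I.X ∨ I.activeParts δ (visited S Ts Ts.length) = ∅ := by
  induction h with
  | finish S h => exact h
  | select S B T Ts hS hZ hB hT hTs ih =>
    rw [List.length_cons, visited_cons_succ]
    exact ih

/-- At a location already visited the scenarios of a part agree, so the largest class is the whole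
part. -/
lemma gain_eq_zero_of_subset {B : V → Finset Ω → Finset Ω} (hB : I.IsLargestPart B)
    {S T : Finset V} (hS : S ⊆ I.X) (hT : T ⊆ S) : I.gain B δ S T = 0 := by
  rw [gain_eq_sum]
  refine Finset.sum_eq_zero fun ω hω => ?_
  have hωM := activeScenarios_subset _ _ hω
  have hno : ¬ ∃ v ∈ T, ω ∉ B v (I.part S ω) := by
    rintro ⟨v, hv, h⟩
    obtain ⟨⟨ω₀, h₀, hB₀⟩, -⟩ :=
      hB v (hS (hT hv)) (I.part S ω) (part_subset _ _) ⟨ω, mem_part_self hωM⟩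
    rw [hB₀] at h
    exact h (Finset.mem_filter.2 ⟨mem_part_self hωM, ((mem_part.1 h₀).2 v (hT hv)).symm⟩)
  rw [scenarioGain, if_neg hno, Finset.union_eq_left.2 hT]
  simp

lemma gain_univ_pos (hI : I.IsValid) (B : V → Finset Ω → Finset Ω)
    {S : Finset V} (hS : S ⊆ I.X) (hZ : I.activeParts δ S ≠ ∅) : 0 < I.gain B δ S I.X := by
  rw [gain_eq_sum]
  have hne : (I.activeScenarios δ S).Nonempty :=
    Finset.nonempty_iff_ne_empty.2 (mt activeParts_eq_empty_iff.2 hZ)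
  refine Finset.sum_pos (fun ω hω => ?_) hne
  have hωM := activeScenarios_subset _ _ hω
  exact mul_pos (hI.p_pos ω hωM) (zero_lt_one.trans_le (one_le_scenarioGain hI hS
    subset_rfl (mem_activeScenarios.1 hω).2.2 (Or.inr (hI.cover ω hωM))))

variable [PseudoMetricSpace (Option V)] {ρ : ℝ}

/-- This makes the planning loop terminate. A tour inside `S` has zero gain, hence ratio `0` even at
length `0`, whereas the tour through all of `X` has positive ratio. -/
lemma exists_notMem_of_output (hI : I.IsValid) (hA : IsRSOApprox ρ A)
    {B : V → Finset Ω → Finset Ω} (hB : I.IsLargestPart B) {S : Finset V} (hS : S ⊆ I.X)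
    (hZ : I.activeParts δ S ≠ ∅) {T : List V} (hT : A I.X (I.gain B δ S) T) :
    ∃ v ∈ T, v ∉ S := by
  by_contra! hsub
  have h := ((hA I.X _ (isMonoSubmodular_gain hI B δ hS)).2 T hT).2 I.X.toList (by simp)
  have h0 : I.gain B δ S T.toFinset = 0 :=
    gain_eq_zero_of_subset hB hS fun v hv => hsub v (List.mem_toFinset.1 hv)
  have hpos := gain_univ_pos hI B hS hZ
  simp only [tourRatio, h0, Finset.toList_toFinset, ENNReal.ofReal_zero, ENNReal.zero_div,
    mul_zero, nonpos_iff_eq_zero, ENNReal.div_eq_zero_iff, ENNReal.ofReal_eq_zero,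
    ENNReal.ofReal_ne_top, or_false] at h
  exact absurd hpos (not_lt.2 h)

lemma exists_plan (hI : I.IsValid) (hA : IsRSOApprox ρ A) (δ : ℝ) (S : Finset V)
    (hS : S ⊆ I.X) : ∃ Ts, I.Plan A δ S Ts := by
  induction hn : (I.X \ S).card using Nat.strong_induction_on generalizing S with
  | _ n ih =>
    by_cases h : S = I.X ∨ I.activeParts δ S = ∅
    · exact ⟨[], Plan.finish S h⟩
    rw [not_or] at h
    obtain ⟨B, hB⟩ := I.exists_isLargestPart
    have hspec := hA I.X _ (isMonoSubmodular_gain hI B δ hS)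
    obtain ⟨T, hT⟩ := hspec.1
    have hTX := (hspec.2 T hT).1
    obtain ⟨v, hvT, hvS⟩ := exists_notMem_of_output hI hA hB hS h.2 hT
    have hlt : (I.X \ (S ∪ T.toFinset)).card < n := by
      rw [← hn]
      refine Finset.card_lt_card (Finset.ssubset_iff_subset_ne.2
        ⟨Finset.sdiff_subset_sdiff subset_rfl Finset.subset_union_left, fun heq => ?_⟩)
      have : v ∈ I.X \ S := Finset.mem_sdiff.2 ⟨hTX v hvT, hvS⟩
      rw [← heq] at this
      exact (Finset.mem_sdiff.1 this).2 (Finset.mem_union_right _ (List.mem_toFinset.2 hvT))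
    obtain ⟨Ts, hTs⟩ := ih _ hlt (S ∪ T.toFinset) (Finset.union_subset hS fun u hu =>
      hTX u (List.mem_toFinset.1 hu)) rfl
    exact ⟨T :: Ts, Plan.select S B T Ts h.1 h.2 hB hT hTs⟩

lemma Plan.visited_subset (hI : I.IsValid) (hA : IsRSOApprox ρ A) {S : Finset V}
    (hS : S ⊆ I.X) {Ts : List (List V)} (h : I.Plan A δ S Ts) (j : ℕ) :
    visited S Ts j ⊆ I.X := by
  induction j with
  | zero => exact hS
  | succ j ih =>
    refine Finset.union_subset ih ?_
    by_cases hj : j < Ts.length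
    · obtain ⟨-, B, -, hT⟩ := h.getD_spec j hj
      exact fun v hv => ((hA I.X _ (isMonoSubmodular_gain hI B δ ih)).2 _ hT).1 v
        (List.mem_toFinset.1 hv)
    · rw [List.getD_eq_default _ _ (not_lt.1 hj)]
      simp

end

/-! ### Execution of one round -/

lemma sensed_append_leg {o : V → O} {w : List (Option V)} {S : Finset V}
    (hw : sensed o w = realization o S) (T : List V) :
    sensed o (w ++ (T.map some ++ [none])) = realization o (S ∪ T.toFinset) := by
  rw [sensed_append, hw, realization_union]
  congr 1
  ext e
  simp [mem_sensed, mem_realization]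

lemma exists_sensed_roundWalk (o : V → O) (rule : Finset (V × O) → Prop) (Ts : List (List V))
    (S : Finset V) (w : List (Option V)) (hw : sensed o w = realization o S) :
    ∃ j ≤ Ts.length, sensed o (roundWalk o rule w (legsOf Ts)) = realization o (visited S Ts j) ∧
      (j < Ts.length → rule (realization o (visited S Ts j))) := by
  induction Ts generalizing S w with
  | nil => exact ⟨0, le_rfl, hw, by simp⟩
  | cons T Ts ih =>
    simp only [legsOf, List.map_cons, roundWalk]
    by_cases hr : rule (sensed o w)
    · rw [if_pos hr]
      exact ⟨0, Nat.zero_le _, hw, fun _ => by rw [visited, ← hw]; exact hr⟩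
    · rw [if_neg hr]
      obtain ⟨j, hj, h1, h2⟩ := ih (S ∪ T.toFinset) _ (sensed_append_leg hw T)
      refine ⟨j + 1, by simpa using hj, ?_, ?_⟩
      · rw [visited_cons_succ]
        exact h1
      · rw [visited_cons_succ]
        intro hlt
        exact h2 (by simpa using hlt)

/-- The terms after the actual stop are nonnegative, so the sum may test the rule at every planned
tour. -/
lemma tourLength_roundWalk_le [PseudoMetricSpace (Option V)] (o : V → O)
    (rule : Finset (V × O) → Prop) (Ts : List (List V))
    (S : Finset V) (w : List (Option V)) (hw : sensed o w = realization o S) :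
    tourLength (roundWalk o rule w (legsOf Ts)) ≤ tourLength w +
      ∑ j ∈ Finset.range Ts.length, if rule (realization o (visited S Ts j)) then 0
        else tourLength ((Ts.getD j []).map some) := by
  induction Ts generalizing S w with
  | nil => simp [legsOf, roundWalk]
  | cons T Ts ih =>
    rw [List.length_cons, Finset.sum_range_succ']
    simp only [legsOf, List.map_cons, roundWalk, visited_cons_succ, List.getD_cons_succ,
      List.getD_cons_zero]
    have hnn : ∀ S' : Finset V, 0 ≤ ∑ j ∈ Finset.range Ts.length,
        if rule (realization o (visited S' Ts j)) then 0
        else tourLength ((Ts.getD j []).map some) := by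
      intro S'
      refine Finset.sum_nonneg fun j _ => ?_
      split_ifs
      · exact le_rfl
      · exact tourLength_nonneg _
    by_cases hr : rule (sensed o w)
    · rw [if_pos hr, visited, if_pos (by rw [← hw]; exact hr)]
      linarith [hnn (S ∪ T.toFinset)]
    · rw [if_neg hr, visited, if_neg (by rw [← hw]; exact hr)]
      have h1 := ih (S ∪ T.toFinset) _ (sensed_append_leg hw T)
      have h2 := tourLength_append_le w (T.map some ++ [none])
      have h3 := tourLength_append_root_le (T.map some)
      have h4 : legsOf Ts = List.map (fun T => List.map some T ++ [none]) Ts := rfl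
      rw [h4] at h1
      linarith

lemma roundWalk_prefix (o : V → O) (rule : Finset (V × O) → Prop)
    (legs : List (List (Option V))) (w : List (Option V)) :
    w <+: roundWalk o rule w legs := by
  induction legs generalizing w with
  | nil => exact List.prefix_rfl
  | cons leg legs ih =>
    rw [roundWalk]
    split_ifs
    · exact List.prefix_rfl
    · exact (List.prefix_append w leg).trans (ih _)

lemma sensed_congr {o o' : V → O} {w : List (Option V)}
    (h : ∀ v, some v ∈ w → o v = o' v) : sensed o w = sensed o' w :=
  realization_congr fun v hv => h v (List.reduceOption_mem_iff.1 (List.mem_toFinset.1 hv))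

/-- A round is steered only by what is observed on its own walk. -/
lemma roundWalk_congr {o o' : V → O} (rule : Finset (V × O) → Prop)
    (legs : List (List (Option V))) (w : List (Option V))
    (h : ∀ v, some v ∈ roundWalk o rule w legs → o v = o' v) :
    roundWalk o' rule w legs = roundWalk o rule w legs := by
  induction legs generalizing w with
  | nil => rfl
  | cons leg legs ih =>
    have hs : sensed o w = sensed o' w :=
      sensed_congr fun v hv => h v ((roundWalk_prefix o rule _ w).subset hv)
    simp only [roundWalk, ← hs] at h ⊢
    split_ifs at h ⊢ with hr
    · rfl
    · exact ih _ h

/-! ### Outcome and expected cost of one round. -/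

section Outcome

/-- The partial realization observed in a round under the scenario `ω`. -/
noncomputable def outcome (I : IPP V Ω O) (rule : Finset (V × O) → Prop) (Ts : List (List V))
    (ω : Ω) : Finset (V × O) :=
  sensed (I.obs ω) (roundWalk (I.obs ω) rule [] (legsOf Ts))

/-- Scenarios compatible with an outcome have the same outcome. -/
lemma outcome_eq_iff (rule : Finset (V × O) → Prop) (Ts : List (List V)) {ω ω' : Ω}
    (hω' : ω' ∈ I.M) :
    I.outcome rule Ts ω' = I.outcome rule Ts ω ↔ ω' ∈ I.compatible (I.outcome rule Ts ω) := by
  rw [mem_compatible]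
  constructor
  · intro h
    refine ⟨hω', fun e he => ?_⟩
    rw [← h] at he
    exact (mem_sensed.1 he).2
  · rintro ⟨-, h⟩
    have hagree : ∀ v, some v ∈ roundWalk (I.obs ω) rule [] (legsOf Ts) →
        I.obs ω v = I.obs ω' v := fun v hv => (h (v, I.obs ω v) (mem_sensed.2 ⟨hv, rfl⟩)).symm
    unfold outcome
    rw [roundWalk_congr rule _ _ hagree, sensed_congr hagree]

/-- The total gain of one scenario over a planned list. -/
lemma sum_scenarioGain_le (hI : I.IsValid) {Ts : List (List V)} {δ : ℝ} (hδ : 0 < δ) (hδ1 : δ ≤ 1)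
    (hX : ∀ j, visited ∅ Ts j ⊆ I.X) (B : ℕ → V → Finset Ω → Finset Ω)
    (hB : ∀ j < Ts.length, I.IsLargestPart (B j)) {ω : Ω} (hω : ω ∈ I.M) :
    ∑ j ∈ Finset.range Ts.length, (if ω ∈ I.activeScenarios δ (visited ∅ Ts j) then
      I.scenarioGain (B j) (visited ∅ Ts j) ω (Ts.getD j []).toFinset else 0) ≤
      (Real.log (1 / δ) / Real.log 2 + 1) + (1 + Real.log (I.Q + 1)) := by
  -- At the times in `E` the scenario lies outside a largest class, so its part halves. The residual
  -- target `F` controls the relative function gains.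
  let E : ℕ → Prop := fun j => j < Ts.length ∧ ω ∈ I.activeScenarios δ (visited ∅ Ts j) ∧
    ∃ v ∈ (Ts.getD j []).toFinset, ω ∉ B j v (I.part (visited ∅ Ts j) ω)
  let F : ℕ → ℕ := fun j => I.Q - I.f (realization (I.obs ω) (visited ∅ Ts j))
  have hfQ : ∀ j, I.f (realization (I.obs ω) (visited ∅ Ts j)) ≤ I.Q := fun j =>
    hI.le_Q _ (fst_mem_of_mem_realization (hX j))
  have hF : ∀ j, F (j + 1) ≤ F j := fun j =>
    Nat.sub_le_sub_left (hI.f_realization_le _ (visited_mono _ _ (Nat.le_succ j)) (hX _)) _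
  have h1 := sum_halving_le (fun j => (I.part (visited ∅ Ts j) ω).card)
    (fun j => Finset.card_le_card (part_anti (visited_mono _ _ (Nat.le_succ j)) ω))
    I.M.card hI.nonempty.card_pos (Finset.card_le_card (part_subset _ _)) δ hδ hδ1 E
    (by
      rintro j ⟨hj, hact, v, hv, hvB⟩
      exact ⟨two_mul_card_part_le (hB j hj) hω
        (hX (j + 1) (Finset.mem_union_right _ hv)) hv hvB, (mem_activeScenarios.1 hact).2.1⟩)
    Ts.length
  have h2 := sum_relative_decrease_le F hF Ts.length
  have h3 : Real.log (F 0) ≤ Real.log (I.Q + 1) := by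
    have hle : (F 0 : ℝ) ≤ (I.Q : ℝ) + 1 := by
      have : F 0 ≤ I.Q + 1 := (Nat.sub_le _ _).trans (Nat.le_succ _)
      exact_mod_cast this
    rcases Nat.eq_zero_or_pos (F 0) with h0 | hpos
    · rw [h0, Nat.cast_zero, Real.log_zero]
      exact Real.log_nonneg (by linarith [(Nat.cast_nonneg I.Q : (0 : ℝ) ≤ I.Q)])
    · exact Real.log_le_log (by exact_mod_cast hpos) hle
  refine le_trans ?_ (add_le_add h1 (h2.trans (add_le_add_right h3 1)))
  rw [← Finset.sum_add_distrib]
  refine Finset.sum_le_sum fun j hj => ?_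
  rw [Finset.mem_range] at hj
  have hrel : ((F j : ℝ) - F (j + 1)) / F j =
      ((I.f (realization (I.obs ω) (visited ∅ Ts j ∪ (Ts.getD j []).toFinset)) : ℝ) -
        I.f (realization (I.obs ω) (visited ∅ Ts j))) /
        ((I.Q : ℝ) - I.f (realization (I.obs ω) (visited ∅ Ts j))) := by
    have hq1 := hfQ (j + 1)
    simp only [visited] at hq1
    simp only [F, visited, Nat.cast_sub (hfQ j), Nat.cast_sub hq1]
    congr 1
    ring
  split_ifs with hact hE hE
  · rw [hrel, scenarioGain, if_pos hE.2.2]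
  · rw [hrel, scenarioGain, if_neg fun h => hE ⟨hj, hact, h⟩]
  · exact absurd hE.2.1 hact
  · rw [zero_add]
    exact div_nonneg (sub_nonneg.2 (by exact_mod_cast hF j)) (Nat.cast_nonneg _)

variable [PseudoMetricSpace (Option V)] {ρ δ : ℝ}
  {A : Finset V → (Finset V → ℝ) → List V → Prop}

/-- The stopping rule holds even after the full list, since planning ends only when all locations
are used or no part is active. -/
lemma exists_outcome_eq (hI : I.IsValid) (hA : IsRSOApprox ρ A) {Ts : List (List V)}
    (h : I.Plan A δ ∅ Ts) {ω : Ω} (hω : ω ∈ I.M) :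
    ∃ R ⊆ I.X, I.outcome (I.stopRule δ) Ts ω = realization (I.obs ω) R ∧
      I.stopRule δ (realization (I.obs ω) R) := by
  obtain ⟨j, hj, h1, h2⟩ := exists_sensed_roundWalk (I.obs ω) (I.stopRule δ) Ts ∅ []
    (by rw [sensed_nil, realization_empty])
  refine ⟨_, h.visited_subset hI hA (Finset.empty_subset _) j, h1, ?_⟩
  rcases hj.lt_or_eq with hlt | rfl
  · exact h2 hlt
  · rcases h.finish_spec with hX | hZ
    · rw [hX, stopRule, hI.cover ω hω]
      simp
    · rw [activeParts_eq_empty_iff] at hZ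
      by_contra hcon
      have : ω ∈ I.activeScenarios δ (visited ∅ Ts Ts.length) := Finset.mem_filter.2 ⟨hω, hcon⟩
      rw [hZ] at this
      simp at this

/-- The expected cost of one round of the partial covering algorithm. -/
lemma expectedCost_round_le (hI : I.IsValid) (hρ : 1 ≤ ρ) (hA : IsRSOApprox ρ A)
    {Ts : List (List V)} (hδ : 0 < δ) (hδ1 : δ ≤ 1) (h : I.Plan A δ ∅ Ts)
    (π : AdaptivePolicy V O) (hπ : I.Covers fun ω => π.walk (I.obs ω)) :
    I.expectedCost (fun ω => roundWalk (I.obs ω) (I.stopRule δ) [] (legsOf Ts)) ≤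
      16 * (ρ * (1 / δ) * (Real.log (1 / δ) + Real.log ((I.Q : ℝ) + 1))) *
        I.expectedCost fun ω => π.walk (I.obs ω) := by
  have hX := h.visited_subset hI hA (Finset.empty_subset _)
  have hBex : ∀ j, ∃ B, j < Ts.length → I.IsLargestPart B ∧
      A I.X (I.gain B δ (visited ∅ Ts j)) (Ts.getD j []) := by
    intro j
    by_cases hj : j < Ts.length
    · obtain ⟨-, B, hB⟩ := h.getD_spec j hj
      exact ⟨B, fun _ => hB⟩
    · exact ⟨fun _ Z => Z, fun hj' => absurd hj' hj⟩
  choose B hB using hBex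
  have hρ0 : 0 ≤ ρ := zero_le_one.trans hρ
  have hlogδ : 0 ≤ Real.log (1 / δ) := Real.log_nonneg (one_le_one_div hδ hδ1)
  have hlogQ : 0 ≤ Real.log ((I.Q : ℝ) + 1) :=
    Real.log_nonneg (by linarith [(Nat.cast_nonneg I.Q : (0 : ℝ) ≤ I.Q)])
  have hopt : 0 ≤ I.expectedCost fun ω => π.walk (I.obs ω) :=
    Finset.sum_nonneg fun ω hω => mul_nonneg (hI.p_nonneg hω) (tourLength_nonneg _)
  -- Tour `j` is paid for only by scenarios still active before it.
  have hcost : I.expectedCost (fun ω => roundWalk (I.obs ω) (I.stopRule δ) [] (legsOf Ts)) ≤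
      ∑ j ∈ Finset.range Ts.length, tourLength ((Ts.getD j []).map some) *
        ∑ ω ∈ I.activeScenarios δ (visited ∅ Ts j), I.p ω := by
    have h1 : ∀ ω ∈ I.M,
        I.p ω * tourLength (roundWalk (I.obs ω) (I.stopRule δ) [] (legsOf Ts)) ≤
        ∑ j ∈ Finset.range Ts.length,
          if ¬ I.stopRule δ (realization (I.obs ω) (visited ∅ Ts j)) then
            tourLength ((Ts.getD j []).map some) * I.p ω else 0 := by
      intro ω hω
      have := tourLength_roundWalk_le (I.obs ω) (I.stopRule δ) Ts ∅ []
        (by rw [sensed_nil, realization_empty])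
      rw [tourLength_nil, zero_add] at this
      refine (mul_le_mul_of_nonneg_left this (hI.p_nonneg hω)).trans_eq ?_
      rw [Finset.mul_sum]
      refine Finset.sum_congr rfl fun j _ => ?_
      rw [ite_not, mul_ite, mul_zero, mul_comm]
    refine (Finset.sum_le_sum h1).trans_eq ?_
    rw [Finset.sum_comm]
    refine Finset.sum_congr rfl fun j _ => ?_
    rw [← Finset.sum_filter, Finset.mul_sum]
    rfl
  have hmain := sum_cost_le_of_greedy I.M I.p (fun ω => tourLength (π.walk (I.obs ω)))
    (fun ω hω => hI.p_nonneg hω) (fun ω _ => tourLength_nonneg _) Ts.length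
    (fun j => tourLength ((Ts.getD j []).map some))
    (fun j => I.activeScenarios δ (visited ∅ Ts j))
    (fun j ω => I.scenarioGain (B j) (visited ∅ Ts j) ω (Ts.getD j []).toFinset)
    (ρ / δ) ((Real.log (1 / δ) / Real.log 2 + 1) + (1 + Real.log (I.Q + 1)))
    (by positivity)
    (by have := div_nonneg hlogδ (Real.log_pos one_lt_two).le; linarith)
    (fun j => activeScenarios_subset _ _)
    (fun i j hij => activeScenarios_anti hI δ (visited_mono _ _ hij) (hX j))
    (fun j _ ω _ => (isMonoSubmodular_scenarioGain hI (B j) (hX j) ω).nonneg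
      (Finset.subset_union_right.trans (hX (j + 1))))
    (fun ω hω => sum_scenarioGain_le hI hδ hδ1 hX B (fun j hj => (hB j hj).1) hω)
    (fun j hj t ht => by
      -- The comparison tour contributes `t / δ` and the approximation guarantee `ρ`, whence `K = ρ
      -- / δ`.
      obtain ⟨hBj, hAj⟩ := hB j hj
      obtain ⟨T', hT'X, hT'len, hT'⟩ := exists_tour_gain_ge hI hBj hδ (hX j) π hπ ht
      have hms := isMonoSubmodular_gain hI (B j) δ (hX j)
      have hgnn := hms.nonneg (Finset.subset_union_right.trans (hX (j + 1)))
      have hratio := mul_tourLength_le_of_tourRatio_le hρ0 hgnn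
        (((hA I.X _ hms).2 _ hAj).2 T' hT'X)
      rw [← gain_eq_sum]
      have h1 := mul_le_mul_of_nonneg_left hT' (tourLength_nonneg ((Ts.getD j []).map some))
      have h2 := mul_le_mul_of_nonneg_left hT'len (mul_nonneg hρ0 hgnn)
      refine (h1.trans ?_).trans (h2.trans_eq ?_)
      · rw [mul_comm]
        exact hratio
      · ring)
    (fun j _ => tourLength_nonneg _)
  rcases Nat.eq_zero_or_pos Ts.length with h0 | hpos
  · rw [h0, Finset.range_zero, Finset.sum_empty] at hcost
    refine hcost.trans (mul_nonneg ?_ hopt)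
    positivity
  have hQ : 1 ≤ I.Q := by
    obtain ⟨hne, -⟩ := h.getD_spec 0 hpos
    rw [Ne, activeParts_eq_empty_iff, ← Ne, ← Finset.nonempty_iff_ne_empty] at hne
    obtain ⟨ω, hω⟩ := hne
    have := (mem_activeScenarios.1 hω).2.2
    omega
  have hl2 := Real.log_two_gt_d9
  have hlogQ2 : Real.log 2 ≤ Real.log ((I.Q : ℝ) + 1) := by
    refine Real.log_le_log two_pos ?_
    have : (1 : ℝ) ≤ I.Q := by exact_mod_cast hQ
    linarith
  have hdiv : Real.log (1 / δ) / Real.log 2 ≤ 2 * Real.log (1 / δ) := by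
    rw [div_le_iff₀ (by linarith)]
    nlinarith
  refine (hcost.trans hmain).trans (mul_le_mul_of_nonneg_right ?_ hopt)
  -- A nonempty plan forces `Q ≥ 1`, and `3 * log 2 ≥ 2` absorbs the additive constants. The
  -- constant `16` is this `4` times that of `sum_cost_le_of_greedy`.
  have hL : (Real.log (1 / δ) / Real.log 2 + 1) + (1 + Real.log ((I.Q : ℝ) + 1)) ≤
      4 * (Real.log (1 / δ) + Real.log ((I.Q : ℝ) + 1)) := by linarith
  calc 4 * (ρ / δ) * ((Real.log (1 / δ) / Real.log 2 + 1) + (1 + Real.log ((I.Q : ℝ) + 1)))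
      ≤ 4 * (ρ / δ) * (4 * (Real.log (1 / δ) + Real.log ((I.Q : ℝ) + 1))) :=
        mul_le_mul_of_nonneg_left hL (by positivity)
    _ = 16 * (ρ * (1 / δ) * (Real.log (1 / δ) + Real.log ((I.Q : ℝ) + 1))) := by ring

end Outcome

end IPP

namespace IPP

variable {V Ω O : Type*} {I : IPP V Ω O}

/-! ### Residual instances -/

section Residual

variable {R : Finset V} {ω : Ω}

lemma mem_residual_X : ∀ {v : V}, v ∈ (I.residual (realization (I.obs ω) R)).X ↔
    v ∈ I.X ∧ v ∉ R := by
  intro v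
  have : (realization (I.obs ω) R).image Prod.fst = R := by
    rw [realization, Finset.image_image]
    exact Finset.image_id
  simp only [residual, this, Finset.mem_sdiff]

lemma mem_residual_M {ω' : Ω} : ω' ∈ (I.residual (realization (I.obs ω) R)).M ↔
    ω' ∈ I.part R ω := by
  rw [← compatible_realization]
  rfl

lemma sum_compatible_pos (hI : I.IsValid) (hω : ω ∈ I.M) :
    0 < ∑ ω' ∈ I.compatible (realization (I.obs ω) R), I.p ω' := by
  rw [compatible_realization]
  exact Finset.sum_pos (fun ω' hω' => hI.p_pos ω' (part_subset _ _ hω')) ⟨ω, mem_part_self hω⟩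

lemma residual_isValid (hI : I.IsValid) (hω : ω ∈ I.M) (hR : R ⊆ I.X) :
    (I.residual (realization (I.obs ω) R)).IsValid := by
  set ψ := realization (I.obs ω) R with hψ
  have hψX : ∀ e ∈ ψ, e.1 ∈ I.X := fst_mem_of_mem_realization hR
  have hsum := sum_compatible_pos (R := R) hI hω
  have hXX : ∀ A : Finset (V × O), (∀ e ∈ A, e.1 ∈ (I.residual ψ).X) →
      ∀ e ∈ ψ ∪ A, e.1 ∈ I.X := fun A hA =>
    fst_mem_union hψX fun e he => (mem_residual_X.1 (hA e he)).1
  refine ⟨?_, ?_, ?_, ?_, ?_, ?_⟩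
  · intro ω' hω'
    exact div_pos (hI.p_pos ω' (part_subset _ _ (mem_residual_M.1 hω'))) hsum
  · simp only [residual]
    rw [← Finset.sum_div]
    exact div_self hsum.ne'
  · intro A B hAB hB
    exact Nat.sub_le_sub_right (hI.mono _ _ (Finset.union_subset_union_right hAB) (hXX B hB)) _
  · intro A B e hAB hB he _
    have h1 := hI.f_insert_add_le (e := e) (Finset.union_subset_union_right (s := ψ) hAB)
      (hXX B hB) (mem_residual_X.1 he).1
    -- Monotonicity keeps the truncated subtractions of `f ψ` exact.
    have h2 := hI.mono ψ (ψ ∪ A) Finset.subset_union_left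
      (hXX A fun e he => hB e (hAB he))
    have h3 := hI.mono ψ (ψ ∪ B) Finset.subset_union_left (hXX B hB)
    have h4 := hI.mono (ψ ∪ A) (insert e (ψ ∪ A)) (Finset.subset_insert _ _) fun e' he' =>
      (Finset.mem_insert.1 he').elim (fun h => h ▸ (mem_residual_X.1 he).1)
        (hXX A (fun e he => hB e (hAB he)) e')
    simp only [residual, Finset.union_insert]
    omega
  · intro A hA
    exact Nat.sub_le_sub_right (hI.le_Q _ (hXX A hA)) _
  · intro ω' hω'
    have hmem := mem_residual_M.1 hω'
    have : ψ ∪ realization (I.obs ω') (I.residual ψ).X = realization (I.obs ω') I.X := by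
      rw [hψ, ← realization_eq_of_mem_part hmem, ← realization_union]
      congr 1
      ext v
      rw [realization_eq_of_mem_part hmem, Finset.mem_union, mem_residual_X]
      constructor
      · rintro (h | h)
        · exact hR h
        · exact h.1
      · intro h
        by_cases hv : v ∈ R
        · exact Or.inl hv
        · exact Or.inr ⟨h, hv⟩
    change I.f (ψ ∪ realization (I.obs ω') (I.residual ψ).X) - I.f ψ = I.Q - I.f ψ
    rw [this, hI.cover ω' (part_subset _ _ hmem)]

/-- Whatever the pruned policy skips is already recorded in the realization on `R`, so together they
contain all that `π` observes. -/
lemma residual_covers_prune (hI : I.IsValid) (hR : R ⊆ I.X) {π : AdaptivePolicy V O}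
    (hπ : I.Covers fun ω => π.walk (I.obs ω)) :
    (I.residual (realization (I.obs ω) R)).Covers fun ω' =>
      (π.prune (realization (I.obs ω) R)).walk (I.obs ω') := by
  set ψ := realization (I.obs ω) R with hψ
  intro ω' hω'
  have hmem := mem_compatible.1 hω'
  obtain ⟨-, hp⟩ := AdaptivePolicy.prune_walk ψ (I.obs ω') hmem.2 π
  obtain ⟨h1, h2⟩ := hπ ω' hmem.1
  refine ⟨fun v hv => ?_, ?_⟩
  · obtain ⟨ha, hb⟩ := (hp v).1 hv
    exact mem_residual_X.2 ⟨h1 v ha, fun hvR => hb ⟨I.obs ω v, mem_realization.2 ⟨hvR, rfl⟩⟩⟩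
  · have hX : ∀ e ∈ ψ ∪ sensed (I.obs ω') ((π.prune ψ).walk (I.obs ω')), e.1 ∈ I.X :=
      fst_mem_union (fst_mem_of_mem_realization hR) fun e he =>
        h1 _ ((hp _).1 (mem_sensed.1 he).1).1
    have hQ : I.f (ψ ∪ sensed (I.obs ω') ((π.prune ψ).walk (I.obs ω'))) = I.Q := by
      refine le_antisymm (hI.le_Q _ hX) ?_
      rw [← h2]
      refine hI.mono _ _ (fun e he => ?_) hX
      rw [mem_sensed] at he
      rw [Finset.mem_union, mem_sensed]
      by_cases hx : ∃ x, (e.1, x) ∈ ψ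
      · left
        obtain ⟨x, hx⟩ := hx
        have hex : e.2 = x := he.2.symm.trans (hmem.2 _ hx)
        rwa [← hex] at hx
      · exact Or.inr ⟨(hp _).2 ⟨he.1, hx⟩, he.2⟩
    change I.f (ψ ∪ sensed (I.obs ω') ((π.prune ψ).walk (I.obs ω'))) - I.f ψ = I.Q - I.f ψ
    rw [hQ]

lemma residual_expectedCost_mul [PseudoMetricSpace (Option V)] (hI : I.IsValid) (hω : ω ∈ I.M)
    (w : Ω → List (Option V)) :
    (∑ ω' ∈ I.compatible (realization (I.obs ω) R), I.p ω') *
      (I.residual (realization (I.obs ω) R)).expectedCost w =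
      ∑ ω' ∈ I.compatible (realization (I.obs ω) R), I.p ω' * tourLength (w ω') := by
  have hsum := sum_compatible_pos (R := R) hI hω
  simp only [expectedCost, residual]
  rw [Finset.mul_sum]
  refine Finset.sum_congr rfl fun ω' _ => ?_
  field_simp

end Residual

/-! ### The parameter of a round -/

section Delta

lemma one_div_delta (I : IPP V Ω O) (k : ℕ) :
    1 / I.delta k = (I.M.card : ℝ) ^ (1 / (k : ℝ)) := by
  rw [delta, Real.rpow_neg (Nat.cast_nonneg _), one_div, inv_inv]

lemma IsValid.one_le_card (hI : I.IsValid) : (1 : ℝ) ≤ I.M.card := by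
  exact_mod_cast hI.nonempty.card_pos

lemma delta_pos (hI : I.IsValid) (k : ℕ) : 0 < I.delta k :=
  Real.rpow_pos_of_pos (zero_lt_one.trans_le hI.one_le_card) _

lemma delta_le_one (hI : I.IsValid) (k : ℕ) : I.delta k ≤ 1 :=
  Real.rpow_le_one_of_one_le_of_nonpos hI.one_le_card (by simp)

lemma delta_succ_mul_card (hI : I.IsValid) (k : ℕ) :
    I.delta (k + 1) * I.M.card = (I.M.card : ℝ) ^ ((k : ℝ) / (k + 1)) := by
  have hm := zero_lt_one.trans_le hI.one_le_card
  have hk : (k : ℝ) + 1 ≠ 0 := by positivity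
  rw [delta]
  nth_rewrite 2 [← Real.rpow_one (I.M.card : ℝ)]
  rw [← Real.rpow_add hm]
  congr 1
  push_cast
  field_simp
  ring

/-- After a round that is not the last one, either the target is reached or few scenarios remain. -/
lemma stopRule_delta_succ (hI : I.IsValid) {k : ℕ} {ω : Ω} {R : Finset V} (hR : R ⊆ I.X)
    (h : I.stopRule (I.delta (k + 1)) (realization (I.obs ω) R)) :
    I.f (realization (I.obs ω) R) = I.Q ∨
      ((I.part R ω).card : ℝ) < (I.M.card : ℝ) ^ ((k : ℝ) / (k + 1)) := by
  rw [stopRule, compatible_realization, delta_succ_mul_card hI, not_and_or, not_le, not_lt] at h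
  rcases h with h | h
  · exact Or.inr h
  · exact Or.inl (le_antisymm (hI.le_Q _ (fst_mem_of_mem_realization hR)) h)

/-- After the last round the target is reached. -/
lemma f_eq_of_stopRule_delta_one (hI : I.IsValid) {ω : Ω} (hω : ω ∈ I.M) {R : Finset V}
    (hR : R ⊆ I.X) (h : I.stopRule (I.delta (0 + 1)) (realization (I.obs ω) R)) :
    I.f (realization (I.obs ω) R) = I.Q := by
  rcases stopRule_delta_succ hI hR h with h | h
  · exact h
  -- With one round left the threshold is `m ^ 0 = 1`, but `ω` is compatible with itself.
  · have : 0 < (I.part R ω).card := Finset.card_pos.2 ⟨ω, mem_part_self hω⟩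
    have h1 : (1 : ℝ) ≤ (I.part R ω).card := by exact_mod_cast this
    simp only [Nat.cast_zero, zero_div, Real.rpow_zero] at h
    exact absurd h (not_lt.2 h1)

end Delta

/-! ### The algorithm with `k` rounds -/

section KAdap

lemma nonempty_kRoundPolicy (k : ℕ) : Nonempty (KRoundPolicy V O k) := by
  induction k with
  | zero => exact ⟨.done⟩
  | succ k ih => exact ih.map fun P => .round [] (fun _ => True) fun _ => P

lemma kRoundPolicy_walk_round (o : V → O) {k : ℕ} (legs : List (List (Option V)))
    (rule : Finset (V × O) → Prop) (next : Finset (V × O) → KRoundPolicy V O k) :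
    (KRoundPolicy.round legs rule next).walk o = roundWalk o rule [] legs ++
      (next (sensed o (roundWalk o rule [] legs))).walk o := by
  rw [KRoundPolicy.walk]

/-- The bound of the remaining rounds, in terms of the instance before the current round. -/
lemma residual_bound_le (hI : I.IsValid) {ρ : ℝ} (hρ : 1 ≤ ρ) {k : ℕ} (hk : 1 ≤ k) {ω : Ω}
    (hω : ω ∈ I.M) {R : Finset V}
    (hcard : ((I.part R ω).card : ℝ) < (I.M.card : ℝ) ^ ((k : ℝ) / (k + 1))) (q : ℕ)
    (hq : q ≤ I.Q) :
    ρ * ((I.part R ω).card : ℝ) ^ (1 / (k : ℝ)) *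
        (Real.log ((I.part R ω).card : ℝ) + (k : ℝ) * Real.log ((q : ℝ) + 1)) ≤
      ρ * (I.M.card : ℝ) ^ (1 / ((k : ℝ) + 1)) *
        ((k : ℝ) / (k + 1) * Real.log (I.M.card : ℝ) + (k : ℝ) * Real.log ((I.Q : ℝ) + 1)) := by
  have hm := zero_lt_one.trans_le hI.one_le_card
  have hk0 : (0 : ℝ) < k := by exact_mod_cast hk
  have hpos : 0 < (I.part R ω).card := Finset.card_pos.2 ⟨ω, mem_part_self hω⟩
  have hone : (1 : ℝ) ≤ (I.part R ω).card := by exact_mod_cast hpos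
  have hρ0 : 0 ≤ ρ := zero_le_one.trans hρ
  have h1 : ((I.part R ω).card : ℝ) ^ (1 / (k : ℝ)) ≤ (I.M.card : ℝ) ^ (1 / ((k : ℝ) + 1)) := by
    refine (Real.rpow_le_rpow (Nat.cast_nonneg _) hcard.le (by positivity)).trans_eq ?_
    rw [← Real.rpow_mul hm.le]
    congr 1
    field_simp
  have h2 : Real.log ((I.part R ω).card : ℝ) ≤ (k : ℝ) / (k + 1) * Real.log (I.M.card : ℝ) := by
    rw [← Real.log_rpow hm]
    exact Real.log_le_log (by linarith) hcard.le
  have h3 : Real.log ((q : ℝ) + 1) ≤ Real.log ((I.Q : ℝ) + 1) := by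
    have : (q : ℝ) ≤ I.Q := by exact_mod_cast hq
    exact Real.log_le_log (by positivity) (by linarith)
  have h4 : 0 ≤ Real.log ((I.part R ω).card : ℝ) := Real.log_nonneg hone
  have h5 : 0 ≤ Real.log ((q : ℝ) + 1) :=
    Real.log_nonneg (by linarith [(Nat.cast_nonneg q : (0 : ℝ) ≤ q)])
  gcongr

lemma bound_nonneg (I : IPP V Ω O) {ρ : ℝ} (hρ : 1 ≤ ρ) (k : ℕ) :
    0 ≤ 16 * (ρ * (I.M.card : ℝ) ^ (1 / (k : ℝ)) *
      (Real.log (I.M.card : ℝ) + (k : ℝ) * Real.log ((I.Q : ℝ) + 1))) := by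
  have h1 := Real.log_natCast_nonneg I.M.card
  have h2 : 0 ≤ Real.log ((I.Q : ℝ) + 1) :=
    Real.log_nonneg (by linarith [(Nat.cast_nonneg I.Q : (0 : ℝ) ≤ I.Q)])
  positivity

/-- Sums over the scenarios, grouped by the outcome of a round. -/
lemma sum_le_sum_of_outcome (rule : Finset (V × O) → Prop) (Ts : List (List V))
    (F : Finset (V × O) → Ω → ℝ) (G : Ω → ℝ)
    (h : ∀ ω ∈ I.M, ∑ ω' ∈ I.compatible (I.outcome rule Ts ω), F (I.outcome rule Ts ω) ω' ≤
      ∑ ω' ∈ I.compatible (I.outcome rule Ts ω), G ω') :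
    ∑ ω ∈ I.M, F (I.outcome rule Ts ω) ω ≤ ∑ ω ∈ I.M, G ω := by
  have hmaps : ∀ ω ∈ I.M, I.outcome rule Ts ω ∈ I.M.image (I.outcome rule Ts) :=
    fun ω hω => Finset.mem_image_of_mem _ hω
  rw [← Finset.sum_fiberwise_of_maps_to hmaps, ← Finset.sum_fiberwise_of_maps_to hmaps]
  refine Finset.sum_le_sum fun ψ hψ => ?_
  obtain ⟨ω, hω, rfl⟩ := Finset.mem_image.1 hψ
  clear hψ
  -- Outcomes partition the scenarios into their compatible sets, so the hypothesis can be applied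
  -- fibre by fibre.
  have hfib : (I.M.filter fun ω' => I.outcome rule Ts ω' = I.outcome rule Ts ω) =
      I.compatible (I.outcome rule Ts ω) := by
    ext ω'
    rw [Finset.mem_filter]
    constructor
    · rintro ⟨h1, h2⟩
      exact (outcome_eq_iff rule Ts h1).1 h2
    · intro h'
      have hM := (mem_compatible.1 h').1
      exact ⟨hM, (outcome_eq_iff rule Ts hM).2 h'⟩
  have hψ := h ω hω
  rw [← hfib] at hψ
  refine le_trans (le_of_eq ?_) hψ
  refine Finset.sum_congr rfl fun ω' hω' => ?_
  rw [(Finset.mem_filter.1 hω').2]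

/-- Nothing is visited once the target is reached. -/
lemma KAdap.walk_eq_nil {A : Finset V → (Finset V → ℝ) → List V → Prop} {k : ℕ}
    {P : KRoundPolicy V O k} (h : KAdap A k I P) (hI : I.IsValid) (hQ : I.f ∅ = I.Q) :
    ∀ ω ∈ I.M, P.walk (I.obs ω) = [] := by
  induction h with
  | zero I => exact fun _ _ => by rw [KRoundPolicy.walk]
  | succ k I Ts next hTs hnext ih =>
    intro ω hω
    have hnil : Ts = [] := by
      cases hTs with
      | finish _ _ => rfl
      | select _ _ _ _ _ hZ _ _ _ =>
        refine absurd (activeParts_eq_empty_iff.2 ?_) hZ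
        rw [Finset.eq_empty_iff_forall_notMem]
        intro ω' hω'
        have := (mem_activeScenarios.1 hω').2.2
        rw [realization_empty, hQ] at this
        exact lt_irrefl _ this
    have hψ : sensed (I.obs ω) (roundWalk (I.obs ω) (I.stopRule (I.delta (k + 1))) []
        (legsOf Ts)) = realization (I.obs ω) ∅ := by
      rw [hnil, realization_empty]
      exact sensed_nil _
    rw [kRoundPolicy_walk_round, hψ]
    have hrw : roundWalk (I.obs ω) (I.stopRule (I.delta (k + 1))) [] (legsOf Ts) = [] := by
      rw [hnil]
      rfl
    rw [hrw, List.nil_append]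
    refine ih ω hω _ hψ.symm (residual_isValid hI hω (Finset.empty_subset _)) ?_ ω
      (mem_residual_M.2 (mem_part_self hω))
    change I.f (realization (I.obs ω) ∅ ∪ ∅) - I.f (realization (I.obs ω) ∅) =
      I.Q - I.f (realization (I.obs ω) ∅)
    rw [realization_empty, Finset.empty_union, hQ]

variable [PseudoMetricSpace (Option V)] {ρ : ℝ}
  {A : Finset V → (Finset V → ℝ) → List V → Prop}

theorem exists_kAdap (hA : IsRSOApprox ρ A) (k : ℕ) (I : IPP V Ω O) (hI : I.IsValid) :
    ∃ P, KAdap A k I P := by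
  induction k generalizing I with
  | zero => exact ⟨_, KAdap.zero I⟩
  | succ k ih =>
    obtain ⟨Ts, hTs⟩ := exists_plan hI hA (I.delta (k + 1)) ∅ (Finset.empty_subset _)
    have hnext : ∀ ψ, ∃ P : KRoundPolicy V O k,
        (∃ ω ∈ I.M, ψ = I.outcome (I.stopRule (I.delta (k + 1))) Ts ω) →
          KAdap A k (I.residual ψ) P := by
      intro ψ
      by_cases h : ∃ ω ∈ I.M, ψ = I.outcome (I.stopRule (I.delta (k + 1))) Ts ω
      · obtain ⟨ω, hω, hψ⟩ := h
        obtain ⟨R, hR, hout, -⟩ := exists_outcome_eq hI hA hTs hω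
        rw [hout] at hψ
        obtain ⟨P, hP⟩ := ih (I.residual ψ) (by rw [hψ]; exact residual_isValid hI hω hR)
        exact ⟨P, fun _ => hP⟩
      -- Realizations that are not outcomes of the round get an arbitrary policy.
      · exact ⟨(nonempty_kRoundPolicy k).some, fun h' => absurd h' h⟩
    choose next hnext using hnext
    exact ⟨_, KAdap.succ k I Ts next hTs fun ω hω ψ hψ => hnext ψ ⟨ω, hω, hψ⟩⟩

/-- The alternative in `hk` lets the induction reach zero rounds, where the last stopping rule has
already forced the target. -/
theorem KAdap.covers (hA : IsRSOApprox ρ A) {k : ℕ} {P : KRoundPolicy V O k}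
    (h : KAdap A k I P) (hI : I.IsValid) (hk : 1 ≤ k ∨ I.f ∅ = I.Q) :
    I.Covers fun ω => P.walk (I.obs ω) := by
  induction h with
  | zero I =>
    intro ω _
    have hQ : I.f ∅ = I.Q := hk.resolve_left (by omega)
    simp only [KRoundPolicy.walk, sensed_nil]
    exact ⟨fun v hv => absurd hv List.not_mem_nil, hQ⟩
  | succ k I Ts next hTs hnext ih =>
    intro ω hω
    obtain ⟨R, hR, hout, hhalt⟩ := exists_outcome_eq hI hA hTs hω
    rw [outcome] at hout
    have hk' : 1 ≤ k ∨ (I.residual (realization (I.obs ω) R)).f ∅ =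
        (I.residual (realization (I.obs ω) R)).Q := by
      rcases Nat.eq_zero_or_pos k with rfl | hk
      · right
        have hQ := f_eq_of_stopRule_delta_one hI hω hR hhalt
        simp only [residual, Finset.union_empty, hQ]
      · exact Or.inl hk
    obtain ⟨h1, h2⟩ := ih ω hω _ hout.symm (residual_isValid hI hω hR) hk' ω
      (mem_residual_M.2 (mem_part_self hω))
    simp only [kRoundPolicy_walk_round, hout]
    change ∀ v, some v ∈ (next (realization (I.obs ω) R)).walk (I.obs ω) →
      v ∈ (I.residual (realization (I.obs ω) R)).X at h1
    change I.f (realization (I.obs ω) R ∪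
        sensed (I.obs ω) ((next (realization (I.obs ω) R)).walk (I.obs ω))) -
      I.f (realization (I.obs ω) R) = I.Q - I.f (realization (I.obs ω) R) at h2
    have hmem : ∀ v, some v ∈ roundWalk (I.obs ω) (I.stopRule (I.delta (k + 1))) []
        (legsOf Ts) → v ∈ R := by
      intro v hv
      have : (v, I.obs ω v) ∈ realization (I.obs ω) R := by
        rw [← hout]
        exact mem_sensed.2 ⟨hv, rfl⟩
      exact (mem_realization.1 this).1
    refine ⟨fun v hv => ?_, ?_⟩
    · rcases List.mem_append.1 hv with hv | hv
      · exact hR (hmem v hv)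
      · exact (mem_residual_X.1 (h1 v hv)).1
    · rw [sensed_append, hout]
      have hX : ∀ e ∈ realization (I.obs ω) R ∪
          sensed (I.obs ω) ((next (realization (I.obs ω) R)).walk (I.obs ω)), e.1 ∈ I.X :=
        fst_mem_union (fst_mem_of_mem_realization hR) fun e he =>
          (mem_residual_X.1 (h1 _ (mem_sensed.1 he).1)).1
      have h3 := hI.mono _ _ Finset.subset_union_left hX
      have h4 := hI.le_Q _ (fst_mem_of_mem_realization (o := I.obs ω) hR)
      omega

lemma expectedCost_nonneg (hI : I.IsValid) (w : Ω → List (Option V)) : 0 ≤ I.expectedCost w :=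
  Finset.sum_nonneg fun _ hω => mul_nonneg (hI.p_nonneg hω) (tourLength_nonneg _)

theorem KAdap.expectedCost_le (hρ : 1 ≤ ρ) (hA : IsRSOApprox ρ A) {k : ℕ}
    {P : KRoundPolicy V O k} (h : KAdap A k I P) (hI : I.IsValid) (hk : 1 ≤ k ∨ I.f ∅ = I.Q)
    (π : AdaptivePolicy V O) (hπ : I.Covers fun ω => π.walk (I.obs ω)) :
    I.expectedCost (fun ω => P.walk (I.obs ω)) ≤
      16 * (ρ * (I.M.card : ℝ) ^ (1 / (k : ℝ)) *
        (Real.log (I.M.card : ℝ) + (k : ℝ) * Real.log ((I.Q : ℝ) + 1))) *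
      I.expectedCost fun ω => π.walk (I.obs ω) := by
  induction h generalizing π with
  | zero I =>
    refine le_trans (le_of_eq ?_) (mul_nonneg (I.bound_nonneg hρ 0) (expectedCost_nonneg hI _))
    simp [expectedCost, KRoundPolicy.walk, tourLength_nil]
  | succ k I Ts next hTs hnext ih =>
    have hm := zero_lt_one.trans_le hI.one_le_card
    have hround := expectedCost_round_le hI hρ hA (delta_pos hI (k + 1)) (delta_le_one hI (k + 1))
      hTs π hπ
    rw [one_div_delta, Real.log_rpow hm] at hround
    set rule := I.stopRule (I.delta (k + 1)) with hrule
    -- This bounds the remaining `k` rounds. The current round supplies the missing `log m / (k +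
    -- 1)` and one `log (Q + 1)`.
    set K : ℝ := 16 * (ρ * (I.M.card : ℝ) ^ (1 / ((k : ℝ) + 1)) *
      ((k : ℝ) / (k + 1) * Real.log (I.M.card : ℝ) +
        (k : ℝ) * Real.log ((I.Q : ℝ) + 1))) with hK
    have hK0 : 0 ≤ K := by
      have h1 := Real.log_natCast_nonneg I.M.card
      have h2 : 0 ≤ Real.log ((I.Q : ℝ) + 1) :=
        Real.log_nonneg (by linarith [(Nat.cast_nonneg I.Q : (0 : ℝ) ≤ I.Q)])
      positivity
    have hrest : ∑ ω ∈ I.M, I.p ω * tourLength ((next (I.outcome rule Ts ω)).walk (I.obs ω)) ≤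
        ∑ ω ∈ I.M, K * (I.p ω * tourLength (π.walk (I.obs ω))) := by
      refine sum_le_sum_of_outcome rule Ts
        (fun ψ ω => I.p ω * tourLength ((next ψ).walk (I.obs ω)))
        (fun ω => K * (I.p ω * tourLength (π.walk (I.obs ω)))) fun ω hω => ?_
      obtain ⟨R, hR, hout, hhalt⟩ := exists_outcome_eq hI hA hTs hω
      have hval := residual_isValid hI hω hR
      rw [← hrule] at hout
      have hKA := hnext ω hω _ hout.symm
      rw [hout]
      have hnn : ∀ ω' ∈ I.compatible (realization (I.obs ω) R),
          0 ≤ K * (I.p ω' * tourLength (π.walk (I.obs ω'))) := fun ω' hω' =>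
        mul_nonneg hK0 (mul_nonneg (hI.p_nonneg (mem_compatible.1 hω').1) (tourLength_nonneg _))
      -- If the target is reached, the number of compatible scenarios is not controlled, but the
      -- remaining walks are empty.
      have hdone : I.f (realization (I.obs ω) R) = I.Q →
          ∑ ω' ∈ I.compatible (realization (I.obs ω) R),
            I.p ω' * tourLength ((next (realization (I.obs ω) R)).walk (I.obs ω')) ≤
          ∑ ω' ∈ I.compatible (realization (I.obs ω) R),
            K * (I.p ω' * tourLength (π.walk (I.obs ω'))) := by
        intro hQ
        refine Finset.sum_le_sum fun ω' hω' => ?_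
        have hnil : (next (realization (I.obs ω) R)).walk (I.obs ω') = [] :=
          KAdap.walk_eq_nil hKA hval
            (by simp only [residual, Finset.union_empty, hQ]) ω' hω'
        rw [hnil, tourLength_nil, mul_zero]
        exact hnn ω' hω'
      rcases Nat.eq_zero_or_pos k with rfl | hkpos
      · exact hdone (f_eq_of_stopRule_delta_one hI hω hR hhalt)
      rcases stopRule_delta_succ hI hR hhalt with hQ | hcard
      · exact hdone hQ
      have hsum := sum_compatible_pos (R := R) hI hω
      have hih := ih ω hω _ hout.symm hval (Or.inl hkpos) _ (residual_covers_prune hI hR hπ)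
      have hMres : (I.residual (realization (I.obs ω) R)).M = I.part R ω :=
        compatible_realization R ω
      have hbound := residual_bound_le hI hρ hkpos hω hcard
        (I.residual (realization (I.obs ω) R)).Q (Nat.sub_le _ _)
      rw [hMres] at hih
      have hih' := hih.trans (mul_le_mul_of_nonneg_right
        (mul_le_mul_of_nonneg_left hbound (by norm_num : (0 : ℝ) ≤ 16))
        (expectedCost_nonneg hval _))
      -- Multiplying by the mass of the compatible scenarios undoes the conditioning of the prior.
      have hmul := mul_le_mul_of_nonneg_left hih' hsum.le
      rw [residual_expectedCost_mul hI hω, mul_left_comm, residual_expectedCost_mul hI hω,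
        ← hK, Finset.mul_sum] at hmul
      refine hmul.trans (Finset.sum_le_sum fun ω' hω' => ?_)
      refine mul_le_mul_of_nonneg_left (mul_le_mul_of_nonneg_left ?_
        (hI.p_nonneg (mem_compatible.1 hω').1)) hK0
      exact returnLength_le_of_sublist
        (AdaptivePolicy.prune_walk _ _ (mem_compatible.1 hω').2 π).1 none
    rw [← Finset.mul_sum] at hrest
    have hsplit : I.expectedCost
        (fun ω => (KRoundPolicy.round (legsOf Ts) rule next).walk (I.obs ω)) ≤
        I.expectedCost (fun ω => roundWalk (I.obs ω) rule [] (legsOf Ts)) +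
          ∑ ω ∈ I.M, I.p ω * tourLength ((next (I.outcome rule Ts ω)).walk (I.obs ω)) := by
      rw [expectedCost, expectedCost, ← Finset.sum_add_distrib]
      refine Finset.sum_le_sum fun ω hω => ?_
      rw [← mul_add, kRoundPolicy_walk_round]
      exact mul_le_mul_of_nonneg_left (tourLength_append_le _ _) (hI.p_nonneg hω)
    refine hsplit.trans ((add_le_add hround hrest).trans_eq ?_)
    change _ + K * I.expectedCost (fun ω => π.walk (I.obs ω)) = _
    rw [← add_mul, hK]
    congr 1
    push_cast
    have hk1 : (k : ℝ) + 1 ≠ 0 := by positivity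
    field_simp
    ring

end KAdap

end IPP

theorem theorem4 :
    ∃ C : ℝ, 0 < C ∧
      ∀ (V Ω O : Type*) [PseudoMetricSpace (Option V)] (I : IPP V Ω O), I.IsValid →
      ∀ (ρ : ℝ), 1 ≤ ρ →
      ∀ (A : Finset V → (Finset V → ℝ) → List V → Prop), IsRSOApprox ρ A →
      ∀ (k : ℕ), 1 ≤ k →
        (∃ P : KRoundPolicy V O k, IPP.KAdap A k I P) ∧
        ∀ P : KRoundPolicy V O k, IPP.KAdap A k I P →
          I.Covers (fun ω => P.walk (I.obs ω)) ∧
          ∀ π : AdaptivePolicy V O, I.Covers (fun ω => π.walk (I.obs ω)) →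
            I.expectedCost (fun ω => P.walk (I.obs ω)) ≤
              C * (ρ * (I.M.card : ℝ) ^ (1 / (k : ℝ)) *
                (Real.log (I.M.card : ℝ) + (k : ℝ) * Real.log ((I.Q : ℝ) + 1))) *
              I.expectedCost (fun ω => π.walk (I.obs ω)) := by
  refine ⟨16, by norm_num, ?_⟩
  intro V Ω O _ I hI ρ hρ A hA k hk
  exact ⟨IPP.exists_kAdap hA k I hI, fun P hP =>
    ⟨hP.covers hA hI (Or.inl hk), fun π hπ => hP.expectedCost_le hρ hA hI (Or.inl hk) π hπ⟩⟩
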